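/- Fix a commutative ring $R$. A directed graph $G$ is a set $V(G)$ of vertices with a set $E(G)\subseteq V(G)\times V(G)$ of edges (loops allowed); a map of directed graphs $G\to G'$ is a function $f$ on vertices such that, for every edge $(x,y)$ of $G$, either $f(x)=f(y)$ or $(f(x),f(y))\in E(G')$. Let $d(x,y)\in\mathbb N\cup\{\infty\}$ be the minimal number of edges of a directed path from $x$ to $y$ ($\infty$ if there is none). The box product $G\square H$ has vertex set $V(G)\times V(H)$, and $((g_1,h_1),(g_2,h_2))$ is an edge iff either $g_1=g_2$ and $(h_1,h_2)\in E(H)$, or $h_1=h_2$ and $(g_1,g_2)\in E(G)$. The reachability chain complex $\mathrm{RC}(G)$ has in degree $k\ge 0$ the free $R$-module on all tuples $(x_0,\dots,x_k)$ of vertices of $G$ with $x_i\neq x_{i+1}$ and with a directed path from $x_i$ to $x_{i+1}$ for each $0\le i<k$; its differential is $\partial(x_0,\dots,x_k)=\sum_{i=0}^k(-1)^i(x_0,\dots,\widehat{x_i},\dots,x_k)$, where terms with repeated consecutive entries are omitted. It is functorial: $(x_0,\dots,x_k)\mapsto(f(x_0),\dots,f(x_k))$, which is read as $0$ if there are repeated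 consecutive entries. It is filtered by letting $F_\ell\mathrm{RC}(G)$ ($\ell\in\mathbb N$) be the span of the generators of length $d(x_0,x_1)+\dots+d(x_{k-1},x_k)\le\ell$. The tensor product $A\otimes B$ of chain complexes over $R$ has differential $\partial(a\otimes b)=\partial a\otimes b+(-1)^{|a|}a\otimes\partial b$; for filtered $A$, $B$ it is filtered by $F_\ell(A\otimes B)=\sum_{s+t=\ell}F_sA\otimes F_tB$ (that is, the sum of the images of these modules in $A\otimes B$). **Theorem (Filtered Eilenberg–Zilber for the reachability chain complex).** For all directed graphs $G$ and $H$, the chain complexes $\mathrm{RC}(G)\otimes\mathrm{RC}(H)$ and $\mathrm{RC}(G\square H)$ are chain homotopy equivalent, via chain maps $$\nabla\colon\mathrm{RC}(G)\otimes\mathrm{RC}(H)\rightleftarrows\mathrm{RC}(G\square H):\Delta$$ and chain homotopies $\Delta\circ\nabla\simeq\mathrm{Id}$ and $\nabla\circ\Delta\simeq\mathrm{Id}$ such that $\nabla$, $\Delta$ and both homotopies are natural with respect to maps of directed graphs in $G$ and in $H$, and all four carry filtration level $\ell$ of their source into filtration level $\ell$ of their target, for every $\ell$. Moreover $\nabla$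 is given on generators by $$\nabla\bigl((g_0,\dots,g_p)\otimes(h_0,\dots,h_q)\bigr)=\sum_\sigma\operatorname{sign}(\sigma)\,\bigl((g_{i_0},h_{j_0}),\dots,(g_{i_r},h_{j_r})\bigr),$$ where $r=p+q$ and $\sigma$ runs over all sequences $((i_0,j_0),\dots,(i_r,j_r))$ of pairs of integers with $0\le i_s\le p$ and $0\le j_s\le q$ in which each term $(i_{s+1},j_{s+1})$ is obtained from $(i_s,j_s)$ by increasing exactly one of the components by $1$. Here $\operatorname{sign}(\sigma)=(-1)^n$, where $n$ is the number of pairs $(i,j)$ of integers with $0\le i\le p$ and $j\ge 0$ that lie strictly below the path $\sigma$, i.e. such that $j<j_s$ for every $s$ with $i_s=i$. -/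

import Mathlib

open CategoryTheory
open scoped TensorProduct

universe u

/-! Directed graphs are Mathlib's `Digraph`: a set of vertices with a set of ordered pairs of
vertices as edges, loops being allowed. -/

namespace Digraph

section Graphs

variable {V W V' W' : Type u}

/-- `G.DirPath n x y`: there is a directed path with `n` edges from `x` to `y` in `G`
(repeated vertices are allowed). -/
inductive DirPath (G : Digraph V) : ℕ → V → V → Prop
  | nil (x : V) : DirPath G 0 x x
  | cons {n : ℕ} {x y z : V} (h : G.Adj x y) (w : DirPath G n y z) : DirPath G (n + 1) x z

/-- There is a directed path from `x` to `y`. -/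
def Reachable (G : Digraph V) (x y : V) : Prop := ∃ n, G.DirPath n x y

/-- The shortest path metric: the minimal number of edges in a directed path from `x` to `y`,
and `⊤` if there is none. -/
noncomputable def dist (G : Digraph V) (x y : V) : ℕ∞ :=
  ⨅ (n : ℕ) (_ : G.DirPath n x y), (n : ℕ∞)

/-- A map of directed graphs: every edge is sent to an edge or collapsed to a vertex. -/
structure Hom (G : Digraph V) (H : Digraph W) where
  toFun : V → W
  map_adj : ∀ x y, G.Adj x y → toFun x = toFun y ∨ H.Adj (toFun x) (toFun y)

/-- The box product of directed graphs. -/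
def box (G : Digraph V) (H : Digraph W) : Digraph (V × W) where
  Adj a b := (a.1 = b.1 ∧ H.Adj a.2 b.2) ∨ (a.2 = b.2 ∧ G.Adj a.1 b.1)

/-- The map of box products induced by a pair of maps of directed graphs. -/
def Hom.box {G : Digraph V} {G' : Digraph V'} {H : Digraph W} {H' : Digraph W'}
    (f : Hom G G') (g : Hom H H') : Hom (G.box H) (G'.box H') where
  toFun a := (f.toFun a.1, g.toFun a.2)
  map_adj := by
    rintro ⟨a, b⟩ ⟨c, d⟩ (⟨h, k⟩ | ⟨h, k⟩)
    · obtain rfl : a = c := h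
      rcases g.map_adj _ _ k with k | k
      · exact Or.inl (Prod.ext rfl k)
      · exact Or.inr (Or.inl ⟨rfl, k⟩)
    · obtain rfl : b = d := h
      rcases f.map_adj _ _ k with k | k
      · exact Or.inl (Prod.ext k rfl)
      · exact Or.inr (Or.inr ⟨rfl, k⟩)

theorem DirPath.trans {G : Digraph V} {m n : ℕ} {x y z : V} (h : G.DirPath m x y)
    (k : G.DirPath n y z) : G.DirPath (m + n) x z := by
  induction h with
  | nil x => simpa using k
  | cons e _ ih => rw [Nat.add_right_comm]; exact .cons e (ih k)

theorem Reachable.refl (G : Digraph V) (x : V) : G.Reachable x x := ⟨0, .nil x⟩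

theorem Reachable.trans {G : Digraph V} {x y z : V} (h : G.Reachable x y)
    (k : G.Reachable y z) : G.Reachable x z := by
  obtain ⟨m, h⟩ := h
  obtain ⟨n, k⟩ := k
  exact ⟨m + n, h.trans k⟩

theorem Reachable.of_adj {G : Digraph V} {x y : V} (h : G.Adj x y) : G.Reachable x y :=
  ⟨1, .cons h (.nil y)⟩

theorem Reachable.map {G : Digraph V} {H : Digraph W} (f : Hom G H) {x y : V}
    (h : G.Reachable x y) : H.Reachable (f.toFun x) (f.toFun y) := by
  obtain ⟨n, h⟩ := h
  induction h with
  | nil x => exact .refl H _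
  | cons e _ ih =>
    rcases f.map_adj _ _ e with e | e
    · rw [e]; exact ih
    · exact (Reachable.of_adj e).trans ih

/-- The inclusion of `G` into `G.box H` at the vertex `b` of `H`. -/
def Hom.inl (G : Digraph V) (H : Digraph W) (b : W) : Hom G (G.box H) where
  toFun a := (a, b)
  map_adj _ _ h := Or.inr (Or.inr ⟨rfl, h⟩)

/-- The inclusion of `H` into `G.box H` at the vertex `a` of `G`. -/
def Hom.inr (G : Digraph V) (H : Digraph W) (a : V) : Hom H (G.box H) where
  toFun b := (a, b)
  map_adj _ _ h := Or.inr (Or.inl ⟨rfl, h⟩)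

/-- Each entry of the tuple `(x 0, …, x k)` has a directed path to the next. -/
def ReachSeq (G : Digraph V) {k : ℕ} (x : Fin (k + 1) → V) : Prop :=
  ∀ i : Fin k, G.Reachable (x i.castSucc) (x i.succ)

theorem ReachSeq.le {G : Digraph V} {k : ℕ} {x : Fin (k + 1) → V} (h : G.ReachSeq x)
    {i j : Fin (k + 1)} (hij : i ≤ j) : G.Reachable (x i) (x j) := by
  induction j using Fin.induction with
  | zero => rw [Fin.le_zero_iff.mp hij]; exact .refl G _
  | succ j ih =>
    rcases hij.eq_or_lt with rfl | hlt
    · exact .refl G _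
    · exact (ih (Fin.le_castSucc_iff.mpr hlt)).trans (h j)

theorem ReachSeq.comp_mono {G : Digraph V} {k l : ℕ} {x : Fin (k + 1) → V} (h : G.ReachSeq x)
    {f : Fin (l + 1) → Fin (k + 1)} (hf : Monotone f) : G.ReachSeq (x ∘ f) :=
  fun i => h.le (hf (Fin.castSucc_le_succ i))

theorem ReachSeq.map {G : Digraph V} {H : Digraph W} (f : Hom G H) {k : ℕ}
    {x : Fin (k + 1) → V} (h : G.ReachSeq x) : H.ReachSeq (f.toFun ∘ x) :=
  fun i => (h i).map f

/-- The generators of the reachability complex in degree `k`: tuples `(x 0, …, x k)` of vertices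
in which consecutive entries are distinct and each entry has a directed path to the next. -/
@[ext]
structure ReachTuple (G : Digraph V) (k : ℕ) where
  vertex : Fin (k + 1) → V
  ne : ∀ i : Fin k, vertex i.castSucc ≠ vertex i.succ
  reach : G.ReachSeq vertex

/-- The length `d(x 0, x 1) + ⋯ + d(x (k-1), x k)` of a tuple. -/
noncomputable def ReachTuple.length {G : Digraph V} {k : ℕ} (x : G.ReachTuple k) : ℕ∞ :=
  ∑ i : Fin k, G.dist (x.vertex i.castSucc) (x.vertex i.succ)

end Graphs

section Complex

variable (R : Type u) [CommRing R] {V W : Type u}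

open Classical in
/-- The tuple `y` as an element of the free module on the generators in degree `k`; it is `0` if
`y` is not a generator, in particular if it has repeated consecutive entries. -/
noncomputable def tupleChain (G : Digraph V) {k : ℕ} (y : Fin (k + 1) → V) :
    G.ReachTuple k →₀ R :=
  if h : (∀ i : Fin k, y i.castSucc ≠ y i.succ) ∧ G.ReachSeq y then
    Finsupp.single ⟨y, h.1, h.2⟩ 1 else 0

theorem tupleChain_vertex (G : Digraph V) {k : ℕ} (x : G.ReachTuple k) :
    G.tupleChain R x.vertex = Finsupp.single x 1 := by
  rw [tupleChain, dif_pos ⟨x.ne, x.reach⟩]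

theorem tupleChain_eq_zero (G : Digraph V) {k : ℕ} (y : Fin (k + 1) → V)
    (i : Fin k) (h : y i.castSucc = y i.succ) : G.tupleChain R y = 0 := by
  rw [tupleChain, dif_neg]
  exact fun H => H.1 i h

/-- The differential: the alternating sum of the tuples in which one entry is discarded, where
any term with repeated consecutive entries is omitted. -/
noncomputable def boundary (G : Digraph V) (k : ℕ) :
    (G.ReachTuple (k + 1) →₀ R) →ₗ[R] (G.ReachTuple k →₀ R) :=
  Finsupp.linearCombination R fun x : G.ReachTuple (k + 1) =>
    ∑ i : Fin (k + 2), (-1 : R) ^ (i : ℕ) • G.tupleChain R (x.vertex ∘ i.succAbove)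

theorem boundary_tupleChain (G : Digraph V) (k : ℕ) (y : Fin (k + 2) → V)
    (hy : G.ReachSeq y) :
    G.boundary R k (G.tupleChain R y) =
      ∑ i : Fin (k + 2), (-1 : R) ^ (i : ℕ) • G.tupleChain R (y ∘ i.succAbove) := by
  by_cases h : ∀ i : Fin (k + 1), y i.castSucc ≠ y i.succ
  · have := tupleChain_vertex R G ⟨y, h, hy⟩
    simp only at this
    rw [this, boundary, Finsupp.linearCombination_single, one_smul]
  · push Not at h
    obtain ⟨a, ha⟩ := h
    rw [tupleChain_eq_zero R G y a ha, map_zero]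
    symm
    rw [Finset.sum_eq_add a.castSucc a.succ (Fin.castSucc_lt_succ).ne]
    · have : y ∘ a.castSucc.succAbove = y ∘ a.succ.succAbove := by
        funext j
        simp only [Function.comp_apply]
        rcases lt_trichotomy j a with hj | rfl | hj
        · rw [Fin.succAbove_of_castSucc_lt _ _ (by simpa using hj),
            Fin.succAbove_of_castSucc_lt _ _ (by rw [Fin.lt_def] at hj ⊢; simp; omega)]
        · simp [ha]
        · rw [Fin.succAbove_of_le_castSucc _ _ (by simpa using hj.le),
            Fin.succAbove_of_le_castSucc _ _ (by rw [Fin.lt_def] at hj; rw [Fin.le_def]; simp; omega)]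
      rw [this, ← add_smul]
      simp [pow_succ]
    · rintro i - ⟨h1, h2⟩
      have h1' : (i : ℕ) ≠ a := fun h => h1 (Fin.ext h)
      have h2' : (i : ℕ) ≠ a + 1 := fun h => h2 (Fin.ext h)
      have ha2 := a.isLt
      have hi := i.isLt
      have key : ∃ b : Fin k, i.succAbove b.castSucc = a.castSucc ∧
          i.succAbove b.succ = a.succ := by
        rcases lt_or_gt_of_ne h1' with hlt | hgt
        · refine ⟨⟨a - 1, by omega⟩, ?_, ?_⟩
          · rw [Fin.succAbove_of_le_castSucc _ _ (by simp [Fin.le_def]; omega)]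
            ext; simp; omega
          · rw [Fin.succAbove_of_le_castSucc _ _ (by simp [Fin.le_def]; omega)]
            ext; simp; omega
        · refine ⟨⟨a, by omega⟩, ?_, ?_⟩
          · rw [Fin.succAbove_of_castSucc_lt _ _ (by simp [Fin.lt_def]; omega)]
            ext; simp
          · rw [Fin.succAbove_of_castSucc_lt _ _ (by simp [Fin.lt_def]; omega)]
            ext; simp
      obtain ⟨b, hb1, hb2⟩ := key
      rw [tupleChain_eq_zero R G _ b (by simp only [Function.comp_apply, hb1, hb2, ha]),
        smul_zero]
    · simp
    · simp

theorem boundary_boundary (G : Digraph V) (k : ℕ) :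
    G.boundary R k ∘ₗ G.boundary R (k + 1) = 0 := by
  ext1 x
  ext1
  have h1 : ∀ i : Fin (k + 3), G.ReachSeq (x.vertex ∘ i.succAbove) := fun i =>
    x.reach.comp_mono (Fin.strictMono_succAbove i).monotone
  simp only [LinearMap.comp_apply, Finsupp.lsingle_apply, LinearMap.zero_comp,
    LinearMap.zero_apply]
  rw [← tupleChain_vertex, boundary_tupleChain R G _ _ x.reach, map_sum]
  simp only [map_smul, boundary_tupleChain R G _ _ (h1 _), Finset.smul_sum, smul_smul,
    ← pow_add]
  rw [← Finset.sum_product']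
  refine Finset.sum_involution
    (fun a _ => ((a.1.succAbove a.2, a.2.predAbove a.1) : Fin (k + 3) × Fin (k + 2)))
    ?_ ?_ ?_ ?_
  · rintro ⟨i, j⟩ -
    have e : (x.vertex ∘ (i.succAbove j).succAbove) ∘ (j.predAbove i).succAbove =
        (x.vertex ∘ i.succAbove) ∘ j.succAbove := by
      funext l
      simp only [Function.comp_apply, Fin.succAbove_succAbove_succAbove_predAbove]
    simp only [e]
    rw [Fin.neg_one_pow_succAbove_add_predAbove, neg_smul, add_neg_cancel]
  · rintro ⟨i, j⟩ - - h
    exact Fin.succAbove_ne i j (congrArg Prod.fst h)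
  · simp
  · rintro ⟨i, j⟩ -
    exact Prod.ext (Fin.succAbove_succAbove_predAbove i j)
      (Fin.predAbove_predAbove_succAbove i j)

/-- The reachability chain complex of a directed graph. -/
noncomputable def RC (G : Digraph V) : ChainComplex (ModuleCat.{u} R) ℕ :=
  ChainComplex.of (fun k => ModuleCat.of R (G.ReachTuple k →₀ R))
    (fun k => ModuleCat.ofHom (G.boundary R k))
    (fun k => by rw [← ModuleCat.ofHom_comp, boundary_boundary]; rfl)

/-- A generator, as an element of the reachability chain complex. -/
noncomputable def ReachTuple.gen {G : Digraph V} {k : ℕ} (x : G.ReachTuple k) :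
    (G.RC R).X k :=
  (Finsupp.single x 1 : G.ReachTuple k →₀ R)

/-- The map `(x 0, …, x k) ↦ (f (x 0), …, f (x k))`, where any term with repeated consecutive
entries is omitted. -/
noncomputable def mapChain {G : Digraph V} {H : Digraph W} (f : Hom G H) (k : ℕ) :
    (G.ReachTuple k →₀ R) →ₗ[R] (H.ReachTuple k →₀ R) :=
  Finsupp.linearCombination R fun x : G.ReachTuple k => H.tupleChain R (f.toFun ∘ x.vertex)

theorem mapChain_tupleChain {G : Digraph V} {H : Digraph W} (f : Hom G H) (k : ℕ)
    (y : Fin (k + 1) → V) (hy : G.ReachSeq y) :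
    mapChain R f k (G.tupleChain R y) = H.tupleChain R (f.toFun ∘ y) := by
  by_cases h : ∀ i : Fin k, y i.castSucc ≠ y i.succ
  · have := tupleChain_vertex R G ⟨y, h, hy⟩
    simp only at this
    rw [this, mapChain, Finsupp.linearCombination_single, one_smul]
  · push Not at h
    obtain ⟨a, ha⟩ := h
    rw [tupleChain_eq_zero R G y a ha, map_zero,
      tupleChain_eq_zero R H _ a (by simp only [Function.comp_apply, ha])]

theorem mapChain_boundary {G : Digraph V} {H : Digraph W} (f : Hom G H) (k : ℕ) :
    H.boundary R k ∘ₗ mapChain R f (k + 1) = mapChain R f k ∘ₗ G.boundary R k := by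
  ext1 x
  ext1
  have h1 : ∀ i : Fin (k + 2), G.ReachSeq (x.vertex ∘ i.succAbove) := fun i =>
    x.reach.comp_mono (Fin.strictMono_succAbove i).monotone
  simp only [LinearMap.comp_apply, Finsupp.lsingle_apply]
  rw [← tupleChain_vertex, boundary_tupleChain R G _ _ x.reach,
    mapChain_tupleChain R f _ _ x.reach, boundary_tupleChain R H _ _ (x.reach.map f), map_sum]
  simp only [map_smul, mapChain_tupleChain R f _ _ (h1 _), Function.comp_assoc]

/-- The chain map of reachability complexes induced by a map of directed graphs. -/
noncomputable def RCmap {G : Digraph V} {H : Digraph W} (f : Hom G H) : G.RC R ⟶ H.RC R :=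
  ChainComplex.ofHom (X := G.RC R) (Y := H.RC R) (fun k => ModuleCat.ofHom (mapChain R f k))
    (fun k => by
      simp only [RC, ChainComplex.of_d]
      exact (ModuleCat.ofHom_comp _ _).symm.trans
        ((congrArg ModuleCat.ofHom (mapChain_boundary R f k)).trans (ModuleCat.ofHom_comp _ _)))

end Complex

section Filtrations

variable {R : Type u} [CommRing R]

/-- A family of submodules `F ℓ k` of the degree `k` parts of a chain complex. -/
abbrev FilFamily (C : ChainComplex (ModuleCat.{u} R) ℕ) : Type u :=
  ℕ → ∀ k : ℕ, Submodule R (C.X k)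

variable (R) in
/-- The length filtration: `F ℓ` is spanned by the generators of length at most `ℓ`. -/
noncomputable def lengthFil {V : Type u} (G : Digraph V) : FilFamily (G.RC R) :=
  fun ℓ k => Submodule.span R {c | ∃ x : G.ReachTuple k, x.length ≤ (ℓ : ℕ∞) ∧ c = x.gen R}

/-- The element `a ⊗ b` of degree `p + q` of the tensor product of two chain complexes. -/
noncomputable def tensorElt {A B : ChainComplex (ModuleCat.{u} R) ℕ} {p q n : ℕ}
    (h : p + q = n) (a : A.X p) (b : B.X q) : (HomologicalComplex.tensorObj A B).X n :=
  (HomologicalComplex.ιTensorObj A B p q n h).hom ((a ⊗ₜ[R] b : (A.X p : Type u) ⊗[R] (B.X q : Type u)))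

/-- The filtration of a tensor product: `F ℓ (A ⊗ B)` is the sum of the (images of the)
`F s A ⊗ F t B` with `s + t = ℓ`. -/
noncomputable def tensorFil {A B : ChainComplex (ModuleCat.{u} R) ℕ} (F : FilFamily A)
    (F' : FilFamily B) : FilFamily (HomologicalComplex.tensorObj A B) :=
  fun ℓ n => Submodule.span R {c | ∃ (s t p q : ℕ) (_ : s + t = ℓ) (h : p + q = n),
    ∃ a ∈ F s p, ∃ b ∈ F' t q, c = tensorElt h a b}

/-- A chain map is filtration-preserving. -/
def IsFilteredMap {A B : ChainComplex (ModuleCat.{u} R) ℕ} (F : FilFamily A) (F' : FilFamily B)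
    (f : A ⟶ B) : Prop :=
  ∀ ℓ k, ∀ a ∈ F ℓ k, (f.f k).hom a ∈ F' ℓ k

/-- A chain homotopy is filtration-preserving. -/
def IsFilteredHomotopy {A B : ChainComplex (ModuleCat.{u} R) ℕ} (F : FilFamily A)
    (F' : FilFamily B) {f g : A ⟶ B} (s : Homotopy f g) : Prop :=
  ∀ ℓ i j, ∀ a ∈ F ℓ i, (s.hom i j).hom a ∈ F' ℓ j

end Filtrations

/-- The sequences `((i 0, j 0), …, (i (p+q), j (p+q)))` with `0 ≤ i s ≤ p` and `0 ≤ j s ≤ q` in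
which each term is obtained from the preceding one by increasing exactly one component by `1`. -/
@[ext]
structure LatticePath (p q : ℕ) where
  pt : Fin (p + q + 1) → Fin (p + 1) × Fin (q + 1)
  step : ∀ s : Fin (p + q),
    (((pt s.succ).1 : ℕ) = (pt s.castSucc).1 + 1 ∧ (pt s.succ).2 = (pt s.castSucc).2) ∨
    ((pt s.succ).1 = (pt s.castSucc).1 ∧ ((pt s.succ).2 : ℕ) = (pt s.castSucc).2 + 1)

noncomputable instance (p q : ℕ) : Fintype (LatticePath p q) :=
  Fintype.ofInjective LatticePath.pt fun _ _ h => LatticePath.ext h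

/-- The number of lattice points `(i, j)`, with `0 ≤ i ≤ p` and `0 ≤ j`, strictly below the path:
`j < j s` for all `s` with `i s = i`. -/
def LatticePath.below {p q : ℕ} (σ : LatticePath p q) : ℕ :=
  (Finset.univ.filter fun a : Fin (p + 1) × Fin (q + 1) =>
    ∀ s, a.1 = (σ.pt s).1 → a.2 < (σ.pt s).2).card

/-- The sign of a lattice path. -/
def LatticePath.sign {p q : ℕ} (σ : LatticePath p q) : ℤ := (-1) ^ σ.below

/-- The generator `((x (i 0), y (j 0)), …, (x (i r), y (j r)))`, where `r = p + q`. -/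
def LatticePath.tuple {V W : Type u} {G : Digraph V} {H : Digraph W} {p q : ℕ}
    (σ : LatticePath p q) (x : G.ReachTuple p) (y : H.ReachTuple q) :
    (G.box H).ReachTuple (p + q) where
  vertex s := (x.vertex (σ.pt s).1, y.vertex (σ.pt s).2)
  ne s h := by
    rcases σ.step s with ⟨h1, -⟩ | ⟨-, h2⟩
    · have hlt : ((σ.pt s.castSucc).1 : ℕ) < p := by have := (σ.pt s.succ).1.isLt; omega
      refine x.ne ⟨(σ.pt s.castSucc).1, hlt⟩ ?_
      have e : (σ.pt s.succ).1 = Fin.succ ⟨(σ.pt s.castSucc).1, hlt⟩ := Fin.ext h1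
      have h' := congrArg Prod.fst h
      simp only [e] at h'
      exact h'
    · have hlt : ((σ.pt s.castSucc).2 : ℕ) < q := by have := (σ.pt s.succ).2.isLt; omega
      refine y.ne ⟨(σ.pt s.castSucc).2, hlt⟩ ?_
      have e : (σ.pt s.succ).2 = Fin.succ ⟨(σ.pt s.castSucc).2, hlt⟩ := Fin.ext h2
      have h' := congrArg Prod.snd h
      simp only [e] at h'
      exact h'
  reach s := by
    rcases σ.step s with ⟨h1, h2⟩ | ⟨h1, h2⟩
    · dsimp only
      rw [h2]
      exact (x.reach.le (Fin.le_def.mpr (by omega))).map (Hom.inl G H _)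
    · dsimp only
      rw [h1]
      exact (y.reach.le (Fin.le_def.mpr (by omega))).map (Hom.inr G H _)

end Digraph

/-! The Eilenberg–Zilber maps are built on one large complex: normalized chains on all lists of
vertices, with no reachability condition and with the empty list kept as an augmentation in degree
`-1`. There every list is `[]` or `v :: l`, and prepending a vertex satisfies `bd (cons v z) = z -
cons v (bd z)`. The shuffle product `sh`, the Alexander–Whitney map `aw` and the homotopy `ht` are
all defined by recursion through `cons`, so each identity (`bd_sh`, `tbd_aw`, `aw_sh`,
`bd_ht_add_ht_bd`) is an induction on lists that uses little beyond this relation. Correction terms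
supported on the empty list appear along the way and disappear in the non-augmented complex.

The composite `aw ∘ sh` is exactly the identity away from the empty list, so one of the two
homotopies is zero. For the other composite `shaw`, the homotopy is the cone construction at the
first vertex: fill `shaw σ - σ` minus the homotopy of the boundary by prepending `v`. Normalization
kills all but two of the resulting terms, leaving `ht (cons v z) = cons v (shaw (cons v z) - ht z)`.
All these formulas are natural for arbitrary functions on vertices.

The filtration rests on two facts. Distances in a box product add (`dist_box`), and no construction
lengthens a chain even when the first vertex of the input is put in front of the output. This
stronger statement (`shL_mem_filFrom`, `awL_mem_tfilFrom`, `htL_mem_filFrom`) survives the recursion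
because prepending a repeated vertex costs `d v v = 0` and other changes of starting vertex are
covered by the triangle inequality.

A list has finite length exactly when each entry reaches the next, so the reachability complex sits
inside the large complex as the span of the nonempty lists of finite length. Preservation of length
therefore also shows that the maps restrict to it. The recursive shuffle is finally expanded as a
signed sum over lattice paths, first for lists of consecutive integers and then in general by
naturality. -/

namespace ListChain

/-- A list with two equal consecutive entries. -/
inductive Degen {V : Type*} : List V → Prop
  | here (v : V) (l : List V) : Degen (v :: v :: l)
  | there (v : V) {l : List V} (h : Degen l) : Degen (v :: l)

theorem Degen.of_not_isChain {V : Type*} {l : List V} (h : ¬ l.IsChain (· ≠ ·)) : Degen l := by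
  induction l with
  | nil => simp at h
  | cons v l ih =>
    cases l with
    | nil => simp at h
    | cons w l =>
      by_cases hvw : v = w
      · subst hvw; exact .here _ _
      · refine .there _ (ih fun h' => h ?_)
        exact List.isChain_cons_cons.2 ⟨hvw, h'⟩

theorem Degen.not_isChain {V : Type*} {l : List V} (h : Degen l) : ¬ l.IsChain (· ≠ ·) := by
  induction h with
  | here v l => simp
  | there v h ih => exact fun h' => ih h'.tail

theorem Degen.map {V W : Type*} (f : V → W) {l : List V} (h : Degen l) : Degen (l.map f) := by
  induction h with
  | here v l => exact .here _ _
  | there v h ih => exact .there _ ih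

/-- The free module on the lists without equal consecutive entries. -/
abbrev NChain (R : Type*) [CommRing R] (V : Type*) := {l : List V // l.IsChain (· ≠ ·)} →₀ R

/-! ### Normalized augmented chains on lists, and the prepending operators. -/

section Basic

variable (R : Type*) [CommRing R] {V W V' W' : Type*} {M : Type*} [AddCommMonoid M] [Module R M]

open Classical in
/-- A list as a normalized chain; it is `0` if the list is degenerate. -/
noncomputable def nl (l : List V) : NChain R V :=
  if h : l.IsChain (· ≠ ·) then Finsupp.single ⟨l, h⟩ 1 else 0

variable {R}

theorem nl_of_isChain {l : List V} (h : l.IsChain (· ≠ ·)) :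
    nl R l = Finsupp.single ⟨l, h⟩ 1 := dif_pos h

theorem nl_eq_zero {l : List V} (h : Degen l) : nl R l = 0 := dif_neg h.not_isChain

@[simp] theorem nl_cons_cons_self (v : V) (l : List V) : nl R (v :: v :: l) = 0 :=
  nl_eq_zero (.here v l)

theorem hom_ext {f g : NChain R V →ₗ[R] M} (h : ∀ l, f (nl R l) = g (nl R l)) : f = g := by
  ext ⟨l, hl⟩
  simpa [nl_of_isChain hl] using h l

theorem hom_ext_apply {f g : NChain R V →ₗ[R] M} (h : ∀ l, f (nl R l) = g (nl R l))
    (z : NChain R V) : f z = g z := by rw [hom_ext h]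

theorem hom_ext₂ {f g : NChain R V →ₗ[R] NChain R W →ₗ[R] M}
    (h : ∀ l m, f (nl R l) (nl R m) = g (nl R l) (nl R m)) : f = g :=
  hom_ext fun l => hom_ext fun m => h l m

variable (R) in
/-- The linear map with prescribed values on lists. -/
noncomputable def lift (f : List V → M) : NChain R V →ₗ[R] M :=
  Finsupp.linearCombination R fun l => f l.1

/-- The basis consists only of nondegenerate lists, but once the prescribed values vanish on
degenerate lists the formula holds for all of them. Later computations can therefore ignore
degeneracy. -/
theorem lift_nl (f : List V → M) (hf : ∀ l, Degen l → f l = 0) (l : List V) :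
    lift R f (nl R l) = f l := by
  by_cases h : l.IsChain (· ≠ ·)
  · simp [nl_of_isChain h, lift]
  · rw [nl_eq_zero (.of_not_isChain h), map_zero, hf _ (.of_not_isChain h)]

/-- Prepending a vertex. -/
noncomputable def cons (v : V) : NChain R V →ₗ[R] NChain R V := lift R fun l => nl R (v :: l)

@[simp] theorem cons_nl (v : V) (l : List V) : cons v (nl R l) = nl R (v :: l) :=
  lift_nl _ (fun _ h => nl_eq_zero (.there v h)) l

@[simp] theorem cons_cons_self (v : V) (z : NChain R V) : cons v (cons v z) = 0 :=
  hom_ext_apply (f := cons v ∘ₗ cons v) (g := 0)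
    (fun l => by simp) z

/-- The map induced by a map of vertices. -/
noncomputable def nmap (f : V → W) : NChain R V →ₗ[R] NChain R W :=
  lift R fun l => nl R (l.map f)

@[simp] theorem nmap_nl (f : V → W) (l : List V) : nmap f (nl R l) = nl R (l.map f) :=
  lift_nl _ (fun _ h => nl_eq_zero (h.map f)) l

@[simp] theorem nmap_cons (f : V → W) (v : V) (z : NChain R V) :
    nmap f (cons v z) = cons (f v) (nmap f z) :=
  hom_ext_apply (f := nmap f ∘ₗ cons v) (g := cons (f v) ∘ₗ nmap f) (fun l => by simp) z

/-- The boundary of a list, in the augmented complex. -/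
noncomputable def bdL : List V → NChain R V
  | [] => 0
  | v :: l => nl R l - cons v (bdL l)

theorem bdL_eq_zero {l : List V} (h : Degen l) : bdL (R := R) l = 0 := by
  induction h with
  | here v l => simp [bdL]
  | there v h ih => simp [bdL, ih, nl_eq_zero h]

/-- The boundary of the augmented complex. -/
noncomputable def bd : NChain R V →ₗ[R] NChain R V := lift R bdL

theorem bd_nl (l : List V) : bd (nl R l) = bdL l := lift_nl _ (fun _ h => bdL_eq_zero h) l

@[simp] theorem bd_nl_nil : bd (nl R ([] : List V)) = 0 := bd_nl _

-- Prepending `v` is a contracting homotopy of the augmented complex. The empty list is kept so that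
-- this holds in every degree without exception.
@[simp] theorem bd_cons (v : V) (z : NChain R V) : bd (cons v z) = z - cons v (bd z) :=
  hom_ext_apply (f := bd ∘ₗ cons v) (g := LinearMap.id - cons v ∘ₗ bd)
    (fun l => by simp [bd_nl, bdL]) z

theorem bd_nl_cons (v : V) (l : List V) :
    bd (nl R (v :: l)) = nl R l - cons v (bd (nl R l)) := by
  rw [← cons_nl, bd_cons]

theorem nmap_bd (f : V → W) (z : NChain R V) : nmap f (bd z) = bd (nmap f z) := by
  refine hom_ext_apply (f := nmap f ∘ₗ bd) (g := bd ∘ₗ nmap f) (fun l => ?_) z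
  simp only [LinearMap.comp_apply]
  induction l with
  | nil => simp
  | cons v l ih => rw [← cons_nl]; simp only [bd_cons, nmap_cons, map_sub, ih]

/-- The sign `(-1) ^ length`. -/
noncomputable def sg : NChain R V →ₗ[R] NChain R V := lift R fun l => (-1 : R) ^ l.length • nl R l

@[simp] theorem sg_nl (l : List V) : sg (nl R l) = (-1 : R) ^ l.length • nl R l :=
  lift_nl _ (fun _ h => by rw [nl_eq_zero h, smul_zero]) l

@[simp] theorem sg_cons (v : V) (z : NChain R V) : sg (cons v z) = -cons v (sg z) :=
  hom_ext_apply (f := sg ∘ₗ cons v) (g := -(cons (R := R) v ∘ₗ sg)) (fun l => by simp [pow_succ]) z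

@[simp] theorem sg_sg (z : NChain R V) : sg (sg z) = z :=
  hom_ext_apply (f := sg ∘ₗ sg) (g := LinearMap.id)
    (fun l => by simp [smul_smul, ← mul_pow]) z

/-- Since `sg` counts the length of a list, which is the degree plus one, the usual Koszul sign is
`-sg`. This accounts for the minus signs in the tensor differentials below. -/
theorem bd_sg (z : NChain R V) : bd (sg z) = -sg (bd z) := by
  refine hom_ext_apply (f := bd ∘ₗ sg) (g := -(sg (R := R) (V := V) ∘ₗ bd)) (fun l => ?_) z
  simp only [LinearMap.comp_apply, LinearMap.neg_apply]
  induction l with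
  | nil => simp
  | cons v l ih => rw [← cons_nl]; simp only [bd_cons, sg_cons, map_sub, map_neg, ih]

variable (R) in
/-- The coefficient of a list at the empty list. -/
def augL : List V → R
  | [] => 1
  | _ :: _ => 0

theorem augL_eq_zero {l : List V} (h : Degen l) : augL R l = 0 := by
  cases h <;> rfl

/-- The coefficient at the empty list. -/
noncomputable def aug : NChain R V →ₗ[R] R := lift R (augL R)

@[simp] theorem aug_nl (l : List V) : aug (nl R l) = augL R l := lift_nl _ (fun _ => augL_eq_zero) l

@[simp] theorem aug_cons (v : V) (z : NChain R V) : aug (cons v z) = 0 :=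
  hom_ext_apply (f := aug ∘ₗ cons v) (g := 0) (fun l => by simp [augL]) z

@[simp] theorem aug_sg (z : NChain R V) : aug (sg z) = aug z :=
  hom_ext_apply (f := aug ∘ₗ sg) (g := aug) (fun l => by cases l <;> simp [augL]) z

end Basic

/-! ### The shuffle product and its boundary formula. -/

section Shuffle

variable {R : Type*} [CommRing R] {V W V' W' : Type*}

variable (R) in
/-- The shuffle product of two lists. -/
noncomputable def shL : List V → List W → NChain R (V × W)
  | [], _ => 0
  | _ :: _, [] => 0
  | a :: x, b :: y => cons (a, b) (shL x (b :: y) + (-1 : R) ^ x.length • shL (a :: x) y +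
      (augL R x * augL R y) • nl R [])
termination_by x y => x.length + y.length

@[simp] theorem shL_nil_left (y : List W) : shL R ([] : List V) y = 0 := by rw [shL]

@[simp] theorem shL_nil_right (x : List V) : shL R x ([] : List W) = 0 := by cases x <;> rw [shL]

/-- A lattice path starting at `(a, b)` either advances in the first list, or advances in the second
with one sign change for each of the `x.length` remaining columns, or ends there. The last summand
is the ending case, nonzero only when both `x` and `y` are empty. -/
theorem shL_cons_cons (a : V) (x : List V) (b : W) (y : List W) :
    shL R (a :: x) (b :: y) = cons (a, b) (shL R x (b :: y) +
      (-1 : R) ^ x.length • shL R (a :: x) y + (augL R x * augL R y) • nl R []) := by rw [shL]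

/-- When the repetition is at the front, one step in the first list gives a chain starting again
with `(v, b)`, which is killed by a second `cons (v, b)`; the other branch has a shorter second
list. -/
theorem shL_eq_zero_left {x : List V} (h : Degen x) (y : List W) : shL R x y = 0 := by
  induction h generalizing y with
  | here v l =>
    induction y with
    | nil => simp
    | cons b y ih => rw [shL_cons_cons, ih, shL_cons_cons]; simp [augL]
  | there v h ih' =>
    induction y with
    | nil => simp
    | cons b y ih => rw [shL_cons_cons, ih, ih', augL_eq_zero h]; simp

theorem shL_eq_zero_right (x : List V) {y : List W} (h : Degen y) : shL R x y = 0 := by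
  induction h generalizing x with
  | here v l =>
    induction x with
    | nil => simp
    | cons b y ih => rw [shL_cons_cons, ih, shL_cons_cons]; simp [augL]
  | there v h ih' =>
    induction x with
    | nil => simp
    | cons b y ih => rw [shL_cons_cons, ih, ih', augL_eq_zero h]; simp

/-- The shuffle product. -/
noncomputable def sh : NChain R V →ₗ[R] NChain R W →ₗ[R] NChain R (V × W) :=
  lift R fun x => lift R fun y => shL R x y

theorem sh_nl (x : List V) (y : List W) : sh (nl R x) (nl R y) = shL R x y := by
  rw [sh, lift_nl, lift_nl]
  · exact fun _ h => shL_eq_zero_right x h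
  · exact fun l h => hom_ext fun m => by
      rw [lift_nl _ fun _ h => shL_eq_zero_right l h, shL_eq_zero_left h]; rfl

@[simp] theorem sh_nil_left (y : NChain R W) : sh (nl R ([] : List V)) y = 0 :=
  hom_ext_apply (f := sh (nl R [])) (g := 0) (fun l => by simp [sh_nl]) y

@[simp] theorem sh_nil_right (x : NChain R V) : sh x (nl R ([] : List W)) = 0 :=
  hom_ext_apply (f := sh.flip (nl R [])) (g := 0) (fun l => by simp [sh_nl]) x

theorem sh_cons_cons (a : V) (x : NChain R V) (b : W) (y : NChain R W) :
    sh (cons a x) (cons b y) = cons (a, b) (sh x (cons b y) + sh (cons a (sg x)) y +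
      (aug x * aug y) • nl R []) := by
  let g : NChain R V →ₗ[R] NChain R W →ₗ[R] NChain R (V × W) :=
    LinearMap.mk₂ R (fun x y => cons (a, b) (sh x (cons b y) + sh (cons a (sg x)) y +
      (aug x * aug y) • nl R []))
      (by intros; simp only [map_add, LinearMap.add_apply, add_mul, add_smul]; abel)
      (by intros; simp only [map_smul, LinearMap.smul_apply, smul_eq_mul, mul_assoc, smul_add,
            mul_smul, map_add])
      (by intros; simp only [map_add, mul_add, add_smul]; abel)
      (by intros; simp only [map_smul, smul_eq_mul, mul_left_comm, smul_add, mul_smul, map_add])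
  refine DFunLike.congr_fun (DFunLike.congr_fun (hom_ext₂ (f := sh.compl₁₂ (cons a) (cons b))
    (g := g) fun l m => ?_) x) y
  simp [g, sh_nl, shL_cons_cons]

/-- The Leibniz rule, corrected in bidegree `(0, 0)`: there the boundary of a single pair is the
empty list, while the products with an empty factor were set to zero. -/
theorem bd_sh (x : NChain R V) (y : NChain R W) :
    bd (sh x y) = sh (bd x) y - sh (sg x) (bd y) + (aug (bd x) * aug (bd y)) • nl R [] := by
  let g : NChain R V →ₗ[R] NChain R W →ₗ[R] NChain R (V × W) :=
    LinearMap.mk₂ R (fun x y => sh (bd x) y - sh (sg x) (bd y) +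
        (aug (bd x) * aug (bd y)) • nl R [])
      (by intros; simp only [map_add, LinearMap.add_apply, add_mul, add_smul]; abel)
      (by intros; simp only [map_smul, LinearMap.smul_apply, smul_eq_mul, mul_assoc, smul_add,
            mul_smul, smul_sub])
      (by intros; simp only [map_add, mul_add, add_smul]; abel)
      (by intros; simp only [map_smul, smul_eq_mul, mul_left_comm, smul_add, mul_smul, smul_sub])
  refine DFunLike.congr_fun (DFunLike.congr_fun (hom_ext₂ (f := sh.compr₂ bd)
    (g := g) fun l m => ?_) x) y
  simp only [g, LinearMap.compr₂_apply, LinearMap.mk₂_apply]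
  clear g x y
  induction l generalizing m with
  | nil => simp
  | cons a x ihx =>
    induction m with
    | nil => simp
    | cons b y ihy =>
      have ihx := ihx (b :: y)
      -- The induction hypothesis is rescaled by the sign of `x`, so that it matches the second
      -- summand of `sh_cons_cons`. After lists are replaced by arbitrary chains, only operator
      -- identities remain.
      have ihy : bd (sh (cons a (sg (nl R x))) (nl R y)) =
          sh (bd (cons a (sg (nl R x)))) (nl R y) - sh (sg (cons a (sg (nl R x)))) (bd (nl R y)) +
            (aug (bd (cons a (sg (nl R x)))) * aug (bd (nl R y))) • nl R [] := by
        simp only [sg_nl, map_smul, cons_nl, LinearMap.smul_apply, ihy]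
        module
      rw [← cons_nl a, ← cons_nl b] at *
      generalize nl R x = X at *
      generalize nl R y = Y at *
      rw [sh_cons_cons, bd_cons, map_add bd, map_add bd, ihx, ihy]
      simp only [bd_cons, map_sub, sh_cons_cons, bd_sg, LinearMap.sub_apply, sg_cons, sg_sg,
        map_neg, LinearMap.neg_apply, map_add, map_smul, bd_nl_nil, smul_zero, aug_cons, aug_sg,
        sub_zero, neg_zero, map_zero, cons_nl]
      module

end Shuffle

/-! ### The Alexander–Whitney map, and its composite with the shuffle product. -/

section AlexanderWhitney

variable {R : Type*} [CommRing R] {V W V' W' : Type*}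

variable (R) in
/-- The Alexander–Whitney map on a list. -/
noncomputable def awL : List (V × W) → NChain R V ⊗[R] NChain R W
  | [] => 0
  | v :: l => nl R [v.1] ⊗ₜ nl R (v.2 :: l.map Prod.snd) + (cons v.1).rTensor _ (awL l)

theorem awL_eq_zero {l : List (V × W)} (h : Degen l) : awL R l = 0 := by
  induction h with
  | here v l =>
    rw [awL, awL, map_add, ← LinearMap.comp_apply (LinearMap.rTensor _ _) (LinearMap.rTensor _ _),
      ← LinearMap.rTensor_comp]
    have : cons (R := R) v.1 ∘ₗ cons v.1 = 0 := LinearMap.ext fun _ => cons_cons_self _ _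
    simp [this]
  | there v h ih => rw [awL, ih, nl_eq_zero (.there _ (h.map _))]; simp

/-- The Alexander–Whitney map. -/
noncomputable def aw : NChain R (V × W) →ₗ[R] NChain R V ⊗[R] NChain R W := lift R (awL R)

theorem aw_nl (l : List (V × W)) : aw (nl R l) = awL R l := lift_nl _ (fun _ => awL_eq_zero) l

@[simp] theorem aw_nl_nil : aw (nl R ([] : List (V × W))) = 0 := aw_nl _

theorem aw_cons (v : V × W) (z : NChain R (V × W)) :
    aw (cons v z) = nl R [v.1] ⊗ₜ cons v.2 (nmap Prod.snd z) + (cons v.1).rTensor _ (aw z) :=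
by
  have h : aw ∘ₗ cons v = TensorProduct.mk R _ _ (nl R [v.1]) ∘ₗ cons v.2 ∘ₗ nmap Prod.snd +
      LinearMap.rTensor (NChain R W) (cons v.1) ∘ₗ aw :=
    hom_ext fun l => by simp [aw_nl, awL]
  exact DFunLike.congr_fun h z

variable (R V W) in
/-- The differential of the tensor product of two augmented complexes. -/
noncomputable def tbd : NChain R V ⊗[R] NChain R W →ₗ[R] NChain R V ⊗[R] NChain R W :=
  LinearMap.rTensor (NChain R W) bd + TensorProduct.map sg (-(bd (R := R) (V := W)))

theorem tbd_tmul (x : NChain R V) (y : NChain R W) :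
    tbd R V W (x ⊗ₜ y) = bd x ⊗ₜ y - sg x ⊗ₜ bd y := by
  simp [tbd, TensorProduct.tmul_neg, sub_eq_add_neg]

theorem tbd_rTensor_cons (v : V) (t : NChain R V ⊗[R] NChain R W) :
    tbd R V W ((cons v).rTensor _ t) = t - (cons v).rTensor _ (tbd R V W t) := by
  induction t with
  | zero => simp
  | add s t hs ht => simp only [map_add, hs, ht]; abel
  | tmul x y =>
    simp only [LinearMap.rTensor_tmul, tbd_tmul, bd_cons, sg_cons, map_sub, TensorProduct.sub_tmul,
      TensorProduct.neg_tmul]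
    abel

/-- The two error terms are the splittings with an empty factor: the recursion always leaves at
least the shared vertex on both sides. -/
theorem tbd_aw (l : List (V × W)) :
    tbd R V W (aw (nl R l)) = aw (bd (nl R l)) + nl R [] ⊗ₜ nl R (l.map Prod.snd) -
      sg (nl R (l.map Prod.fst)) ⊗ₜ nl R [] := by
  induction l with
  | nil => simp
  | cons v l ih =>
    rw [← cons_nl, aw_cons, map_add, tbd_rTensor_cons, ih, tbd_tmul, bd_cons v, map_sub (aw (R := R) (V := V) (W := W)), aw_cons,
      ← cons_nl v.1, bd_cons, bd_cons, nmap_bd, nmap_nl, List.map_cons, List.map_cons,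
      ← cons_nl v.1, ← cons_nl v.2, sg_cons, sg_cons]
    simp [TensorProduct.tmul_sub, TensorProduct.neg_tmul]
    abel

/-- Any step in the first list repeats an entry of the second, so the projection vanishes unless `x`
is a single vertex. The scalar `aug (bd (nl R x))` detects that case. -/
theorem nmap_snd_sh (x : List V) (y : List W) :
    nmap Prod.snd (sh (nl R x) (nl R y)) =
      aug (bd (nl R x)) • (nl R y - aug (nl R y) • nl R []) := by
  induction x generalizing y with
  | nil => simp
  | cons a x ihx =>
    induction y with
    | nil => simp [augL]
    | cons b y ihy =>
      have ihx := ihx (b :: y)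
      have ihy : nmap Prod.snd (sh (cons a (sg (nl R x))) (nl R y)) =
          aug (bd (cons a (sg (nl R x)))) • (nl R y - aug (nl R y) • nl R []) := by
        simp only [sg_nl, map_smul, cons_nl, LinearMap.smul_apply, ihy]
        module
      rw [← cons_nl a, ← cons_nl b] at *
      generalize nl R x = X at *
      generalize nl R y = Y at *
      rw [sh_cons_cons, nmap_cons, map_add (nmap _), map_add (nmap _), ihx, ihy]
      simp only [bd_cons, map_sub, aug_cons, aug_sg, sub_zero, map_add, map_smul, zero_smul,
        cons_cons_self, smul_zero, nmap_nl, List.map_nil]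
      module

/-- Splitting off the first point of the shuffle involves only its projection to the second factor,
computed by `nmap_snd_sh`. In the remaining part, the branch that keeps `a` in front yields a
repeated `a` and dies under `cons a`. -/
theorem aw_sh_nl (x : List V) (y : List W) :
    aw (sh (nl R x) (nl R y)) =
      (nl R x - aug (nl R x) • nl R []) ⊗ₜ (nl R y - aug (nl R y) • nl R []) := by
  induction x generalizing y with
  | nil => simp [augL]
  | cons a x ihx =>
    induction y with
    | nil => simp [augL]
    | cons b y ihy =>
      have ihx := ihx (b :: y)
      have ihy : aw (sh (cons a (sg (nl R x))) (nl R y)) =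
          (cons a (sg (nl R x))) ⊗ₜ (nl R y - aug (nl R y) • nl R []) := by
        simp only [sg_nl, map_smul, cons_nl, LinearMap.smul_apply, ihy]
        simp [augL, TensorProduct.smul_tmul']
      have hx := nmap_snd_sh (R := R) x (b :: y)
      have hy : nmap Prod.snd (sh (cons a (sg (nl R x))) (nl R y)) =
          aug (nl R x) • (nl R y - aug (nl R y) • nl R []) := by
        have h := nmap_snd_sh (R := R) (a :: x) y
        rw [← cons_nl, bd_cons, map_sub, aug_cons, sub_zero] at h
        rw [sg_nl, map_smul, map_smul, LinearMap.smul_apply, map_smul, h, smul_smul]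
        cases x <;> simp [augL]
      rw [← cons_nl a, ← cons_nl b] at *
      generalize nl R x = X at *
      generalize nl R y = Y at *
      rw [sh_cons_cons, aw_cons, map_add (nmap _), map_add (nmap _), hx, hy, map_add (aw (R := R)), map_add (aw (R := R)),
        ihx, ihy, ← cons_nl a]
      simp only [map_add, map_sub, map_smul, LinearMap.rTensor_tmul, cons_cons_self, smul_zero,
        aug_cons, zero_smul, sub_zero, zero_add, add_zero, aw_nl_nil, TensorProduct.zero_tmul, nmap_nl,
        List.map_nil, TensorProduct.tmul_add, TensorProduct.tmul_sub, TensorProduct.tmul_smul,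
        TensorProduct.sub_tmul, TensorProduct.smul_tmul']
      simp only [← TensorProduct.smul_tmul', smul_sub]
      module

theorem aw_sh (x : NChain R V) (y : NChain R W) :
    aw (sh x y) = (x - aug x • nl R []) ⊗ₜ (y - aug y • nl R []) := by
  let p : NChain R V →ₗ[R] NChain R V := LinearMap.id - (aug (R := R)).smulRight (nl R [])
  let p' : NChain R W →ₗ[R] NChain R W := LinearMap.id - (aug (R := R)).smulRight (nl R [])
  have h : sh.compr₂ aw = (TensorProduct.mk R _ _).compl₁₂ p p' := hom_ext₂ fun l m => by
    rw [LinearMap.compr₂_apply, aw_sh_nl]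
    rfl
  exact DFunLike.congr_fun (DFunLike.congr_fun h x) y

end AlexanderWhitney

/-! ### The homotopy from `shaw` to the identity. -/

section Homotopy

variable {R : Type*} [CommRing R] {V W : Type*}

variable (R V W) in
/-- The Alexander–Whitney map followed by the shuffle product. -/
noncomputable def shaw : NChain R (V × W) →ₗ[R] NChain R (V × W) := TensorProduct.lift sh ∘ₗ aw

theorem bd_lift_sh (t : NChain R V ⊗[R] NChain R W) :
    bd (TensorProduct.lift sh t) = TensorProduct.lift sh (tbd R V W t) +
      (LinearMap.mul' R R (TensorProduct.map (aug ∘ₗ bd) (aug ∘ₗ bd) t)) • nl R [] := by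
  induction t with
  | zero => simp
  | add s t hs ht => simp only [map_add, hs, ht]; module
  | tmul x y => simp [tbd_tmul, bd_sh]

/-- Both sides are `1` on a list of length one and `0` otherwise: the two factors of a splitting are
both single vertices only when the list itself is. -/
theorem augAug_aw (l : List (V × W)) :
    LinearMap.mul' R R (TensorProduct.map (aug ∘ₗ bd) (aug ∘ₗ bd) (aw (nl R l))) =
      aug (bd (nl R l)) := by
  have key : ∀ (v : V) (t : NChain R V ⊗[R] NChain R W),
      TensorProduct.map (aug ∘ₗ bd) (aug ∘ₗ bd) ((cons v).rTensor _ t) =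
        TensorProduct.map aug (aug ∘ₗ bd) t := by
    intro v t
    induction t with
    | zero => simp
    | add s t hs ht => simp only [map_add, hs, ht]
    | tmul x y => simp
  have key0 : ∀ (v : V) (t : NChain R V ⊗[R] NChain R W),
      TensorProduct.map aug (aug ∘ₗ bd) ((cons v).rTensor _ t) = (0 : R ⊗[R] R) := by
    intro v t
    induction t with
    | zero => simp
    | add s t hs ht => simp only [map_add, hs, ht, add_zero]
    | tmul x y => simp
  have key2 : ∀ (l : List (V × W)), TensorProduct.map aug (aug ∘ₗ bd) (aw (nl R l)) = 0 := by
    intro l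
    cases l with
    | nil => simp
    | cons v l =>
      rw [← cons_nl, aw_cons, map_add, key0]
      simp [augL]
  cases l with
  | nil => simp
  | cons v l =>
    rw [← cons_nl, aw_cons, map_add, key, key2, bd_cons]
    cases l <;> simp [bd_nl_cons, augL]

theorem bd_shaw (z : NChain R (V × W)) :
    bd (shaw R V W z) = shaw R V W (bd z) + aug (bd z) • nl R [] := by
  refine hom_ext_apply (f := bd ∘ₗ shaw R V W) (g := shaw R V W ∘ₗ bd +
    (aug ∘ₗ bd).smulRight (nl R [])) (fun l => ?_) z
  simp [shaw, bd_lift_sh, augAug_aw, tbd_aw]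

variable (R) in
/-- The homotopy on a list. -/
noncomputable def htL : List (V × W) → NChain R (V × W)
  | [] => 0
  | v :: l => cons v (shaw R V W (nl R (v :: l)) - htL l)

theorem htL_eq_zero {l : List (V × W)} (h : Degen l) : htL R l = 0 := by
  induction h with
  | here v l => simp [htL]
  | there v h ih => simp [htL, ih, nl_eq_zero (h.there v)]

/-- The homotopy. -/
noncomputable def ht : NChain R (V × W) →ₗ[R] NChain R (V × W) := lift R (htL R)

theorem ht_nl (l : List (V × W)) : ht (nl R l) = htL R l := lift_nl _ (fun _ => htL_eq_zero) l

@[simp] theorem ht_nl_nil : ht (nl R ([] : List (V × W))) = 0 := ht_nl _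

/-- This is the cone formula `cons v (shaw σ - σ - ht (bd σ))` for `σ = cons v z`: both `σ` and `ht
(cons v (bd z))` begin with `v`, so `cons v` annihilates them. -/
theorem ht_cons (v : V × W) (z : NChain R (V × W)) :
    ht (cons v z) = cons v (shaw R V W (cons v z) - ht z) :=
by
  have h : ht ∘ₗ cons v = cons v ∘ₗ (shaw R V W ∘ₗ cons v - ht) :=
    hom_ext fun l => by
      simp only [LinearMap.comp_apply, LinearMap.sub_apply, cons_nl, ht_nl]
      rw [htL]
  exact DFunLike.congr_fun h z

theorem bd_ht_add_ht_bd (z : NChain R (V × W)) :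
    bd (ht z) + ht (bd z) = shaw R V W z - z + aug z • nl R [] := by
  refine hom_ext_apply (f := bd ∘ₗ ht + ht ∘ₗ bd) (g := shaw R V W - LinearMap.id +
    aug.smulRight (nl R [])) (fun l => ?_) z
  simp only [LinearMap.add_apply, LinearMap.comp_apply, LinearMap.sub_apply, LinearMap.id_apply,
    LinearMap.smulRight_apply]
  induction l with
  | nil => simp [shaw, augL]
  | cons v l ih =>
    rw [← cons_nl]
    generalize nl R l = X at *
    have h1 := bd_shaw (cons v X)
    simp only [bd_cons, map_sub, aug_cons, sub_zero] at h1
    -- Expanding the boundary, the terms `shaw (cons v (bd z))` cancel, and what is left differs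
    -- from the goal by `cons v` applied to the induction hypothesis.
    have ih := congrArg (cons v) ih
    simp only [map_add, map_sub, map_smul] at ih
    simp only [ht_cons, bd_cons, map_sub, h1, map_add, aug_cons, map_smul, zero_smul, add_zero]
    rw [eq_comm, ← sub_eq_zero] at ih
    rw [← sub_eq_zero, ← neg_zero, ← ih]
    module

end Homotopy

/-! ### Naturality for arbitrary maps of vertices. -/

section Naturality

variable {R : Type*} [CommRing R] {V W V' W' : Type*} (f : V → V') (g : W → W')

theorem nmap_shL (x : List V) (y : List W) :
    nmap (Prod.map f g) (shL R x y) = shL R (x.map f) (y.map g) := by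
  induction x generalizing y with
  | nil => simp
  | cons a x ihx =>
    induction y with
    | nil => simp
    | cons b y ihy =>
      have h : ∀ {V V' : Type _} (f : V → V') (l : List V), augL R (l.map f) = augL R l :=
        fun f l => by cases l <;> rfl
      have h' : ∀ {V V' : Type _} (f : V → V') (l : List V), augL R (l.map f) = augL R l :=
        fun f l => by cases l <;> rfl
      rw [shL_cons_cons, nmap_cons, map_add (nmap _), map_add (nmap _), ihx, map_smul, ihy, map_smul, nmap_nl,
        List.map_cons, List.map_cons, shL_cons_cons, h, h', List.length_map]
      rfl

theorem nmap_sh (x : NChain R V) (y : NChain R W) :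
    nmap (Prod.map f g) (sh x y) = sh (nmap f x) (nmap g y) := by
  have h : sh.compr₂ (nmap (Prod.map f g)) = sh.compl₁₂ (nmap (R := R) f) (nmap g) :=
    hom_ext₂ fun l m => by simp [sh_nl, nmap_shL]
  exact DFunLike.congr_fun (DFunLike.congr_fun h x) y

theorem nmap_lift_sh (t : NChain R V ⊗[R] NChain R W) :
    nmap (Prod.map f g) (TensorProduct.lift sh t) =
      TensorProduct.lift sh (TensorProduct.map (nmap f) (nmap g) t) := by
  induction t with
  | zero => simp
  | add s t hs ht => simp only [map_add, hs, ht]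
  | tmul x y => simp [nmap_sh]

theorem map_nmap_aw (z : NChain R (V × W)) :
    TensorProduct.map (nmap f) (nmap g) (aw z) = aw (nmap (Prod.map f g) z) := by
  have h : TensorProduct.map (nmap f) (nmap g) ∘ₗ aw (R := R) = aw ∘ₗ nmap (Prod.map f g) := by
    refine hom_ext fun l => ?_
    simp only [LinearMap.comp_apply]
    induction l with
    | nil => simp
    | cons v l ih =>
      have key : ∀ t : NChain R V ⊗[R] NChain R W,
          TensorProduct.map (nmap f) (nmap g) ((cons v.1).rTensor _ t) =
            (cons (f v.1)).rTensor _ (TensorProduct.map (nmap f) (nmap g) t) := by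
        intro t
        induction t with
        | zero => simp
        | add s t hs ht => simp only [map_add, hs, ht]
        | tmul x y => simp
      rw [← cons_nl, aw_cons, map_add, key, ih, nmap_cons, aw_cons]
      simp [Function.comp_def]
  exact DFunLike.congr_fun h z

theorem nmap_shaw (z : NChain R (V × W)) :
    nmap (Prod.map f g) (shaw R V W z) = shaw R V' W' (nmap (Prod.map f g) z) := by
  simp only [shaw, LinearMap.comp_apply, nmap_lift_sh, map_nmap_aw]

theorem nmap_ht (z : NChain R (V × W)) :
    nmap (Prod.map f g) (ht z) = ht (nmap (Prod.map f g) z) := by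
  have h : nmap (Prod.map f g) ∘ₗ ht (R := R) = ht ∘ₗ nmap (Prod.map f g) := by
    refine hom_ext fun l => ?_
    simp only [LinearMap.comp_apply]
    induction l with
    | nil => simp
    | cons v l ih => rw [← cons_nl, ht_cons, nmap_cons, map_sub, ih, nmap_cons, ht_cons,
        nmap_shaw, nmap_cons]
  exact DFunLike.congr_fun h z

end Naturality
end ListChain

namespace ListChain

/-! ### Length estimates. -/

section Filtration

variable {V W : Type*}

/-- The length of a list with respect to a distance. -/
def len (d : V → V → ℕ∞) : List V → ℕ∞
  | [] => 0
  | [_] => 0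
  | v :: w :: l => d v w + len d (w :: l)

/-- The sum of two distances on a product. -/
def dbox (d : V → V → ℕ∞) (d' : W → W → ℕ∞) (a b : V × W) : ℕ∞ := d a.1 b.1 + d' a.2 b.2

/-- The triangle inequality and `d x x = 0`. -/
structure IsQuasiDist (d : V → V → ℕ∞) : Prop where
  self (x : V) : d x x = 0
  triangle (x y z : V) : d x z ≤ d x y + d y z

theorem len_le_len_cons (d : V → V → ℕ∞) (v : V) (l : List V) : len d l ≤ len d (v :: l) := by
  cases l with
  | nil => exact zero_le
  | cons w l => exact le_add_self

theorem len_cons_le {d : V → V → ℕ∞} (hd : IsQuasiDist d) (v w : V)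
    (l : List V) : len d (v :: l) ≤ d v w + len d (w :: l) := by
  cases l with
  | nil => exact zero_le
  | cons a l => simp only [len, ← add_assoc]; gcongr; exact hd.triangle _ _ _

theorem len_map_snd_le (d : V → V → ℕ∞) (d' : W → W → ℕ∞) (l : List (V × W)) :
    len d' (l.map Prod.snd) ≤ len (dbox d d') l := by
  induction l with
  | nil => exact le_rfl
  | cons v l ih =>
    cases l with
    | nil => exact le_rfl
    | cons w l => exact add_le_add le_add_self ih

variable {R : Type*} [CommRing R]

variable (R) in
/-- The chains of degree `n` and length at most `ℓ`. -/
noncomputable def fil (d : V → V → ℕ∞) (ℓ : ℕ∞) (n : ℕ) : Submodule R (NChain R V) :=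
  Submodule.span R {z | ∃ l : List V, l.length = n + 1 ∧ len d l ≤ ℓ ∧ z = nl R l}

variable (R) in
/-- The chains of degree `n` whose length is at most `ℓ` after prepending `v`. -/
noncomputable def filFrom (d : V → V → ℕ∞) (v : V) (ℓ : ℕ∞) (n : ℕ) :
    Submodule R (NChain R V) :=
  Submodule.span R {z | ∃ l : List V, l.length = n + 1 ∧ len d (v :: l) ≤ ℓ ∧ z = nl R l}

variable (R) in
/-- The tensors of degree `n` and length at most `ℓ`. -/
noncomputable def tfil (d : V → V → ℕ∞) (d' : W → W → ℕ∞) (ℓ : ℕ∞) (n : ℕ) :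
    Submodule R (NChain R V ⊗[R] NChain R W) :=
  Submodule.span R {t | ∃ (p q : ℕ) (x : List V) (y : List W), x.length = p + 1 ∧
    y.length = q + 1 ∧ p + q = n ∧ len d x + len d' y ≤ ℓ ∧ t = nl R x ⊗ₜ nl R y}

theorem nl_mem_fil {d : V → V → ℕ∞} {l : List V} {ℓ : ℕ∞} {n : ℕ} (h : l.length = n + 1)
    (hl : len d l ≤ ℓ) : nl R l ∈ fil R d ℓ n := Submodule.subset_span ⟨l, h, hl, rfl⟩

theorem nl_mem_filFrom {d : V → V → ℕ∞} {v : V} {l : List V} {ℓ : ℕ∞} {n : ℕ}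
    (h : l.length = n + 1) (hl : len d (v :: l) ≤ ℓ) : nl R l ∈ filFrom R d v ℓ n :=
  Submodule.subset_span ⟨l, h, hl, rfl⟩

theorem nl_tmul_nl_mem_tfil {d : V → V → ℕ∞} {d' : W → W → ℕ∞} {x : List V} {y : List W} {ℓ : ℕ∞}
    {p q n : ℕ} (hx : x.length = p + 1) (hy : y.length = q + 1) (hn : p + q = n)
    (h : len d x + len d' y ≤ ℓ) : nl R x ⊗ₜ nl R y ∈ tfil R d d' ℓ n :=
  Submodule.subset_span ⟨p, q, x, y, hx, hy, hn, h, rfl⟩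

theorem filFrom_le_fil (d : V → V → ℕ∞) (v : V) (ℓ : ℕ∞) (n : ℕ) :
    filFrom R d v ℓ n ≤ fil R d ℓ n := by
  refine Submodule.span_le.2 ?_
  rintro _ ⟨l, h, hl, rfl⟩
  exact nl_mem_fil h ((len_le_len_cons d v l).trans hl)

/-- Moving the prepended vertex from `w` back to `v` costs at most `d v w`, by the triangle
inequality. -/
theorem filFrom_mono {d : V → V → ℕ∞} (hd : IsQuasiDist d) {v w : V}
    {ℓ ℓ' : ℕ∞} (h' : d v w + ℓ ≤ ℓ') (n : ℕ) : filFrom R d w ℓ n ≤ filFrom R d v ℓ' n := by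
  refine Submodule.span_le.2 ?_
  rintro _ ⟨l, h, hl, rfl⟩
  exact nl_mem_filFrom h (((len_cons_le hd v w l).trans (add_le_add_right hl _)).trans h')

/-- Prepending `v` twice has the same length as prepending it once, because `d v v = 0`. Tracking
length from a base vertex thus makes `cons` cost nothing. -/
theorem cons_mem_filFrom {d : V → V → ℕ∞} (hd : IsQuasiDist d) {v : V} {ℓ : ℕ∞} {n : ℕ}
    {z : NChain R V} (hz : z ∈ filFrom R d v ℓ n) : cons v z ∈ filFrom R d v ℓ (n + 1) := by
  suffices filFrom R d v ℓ n ≤ (filFrom R d v ℓ (n + 1)).comap (cons v) from this hz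
  refine Submodule.span_le.2 ?_
  rintro _ ⟨l, h, hl, rfl⟩
  rw [SetLike.mem_coe, Submodule.mem_comap, cons_nl]
  exact nl_mem_filFrom (by simp [h]) (by simpa [len, hd.self] using hl)

variable {d : V → V → ℕ∞} {d' : W → W → ℕ∞}

theorem IsQuasiDist.dbox (hd : IsQuasiDist d) (hd' : IsQuasiDist d') :
    IsQuasiDist (dbox d d') where
  self x := by simp [ListChain.dbox, hd.self, hd'.self]
  triangle x y z := by
    simp only [ListChain.dbox]
    rw [add_add_add_comm]
    exact add_le_add (hd.triangle _ _ _) (hd'.triangle _ _ _)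

/-- Each step of a lattice path moves in one factor only, so it costs exactly the corresponding
distance there. The auxiliary facts `left` and `right` are the two kinds of step. -/
theorem shL_mem_filFrom (hd : IsQuasiDist d) (hd' : IsQuasiDist d')
    (a : V) (x : List V) (b : W) (y : List W) :
    shL R (a :: x) (b :: y) ∈
      filFrom R (dbox d d') (a, b) (len d (a :: x) + len d' (b :: y)) (x.length + y.length) := by
  have H := hd.dbox hd'
  have right (a : V) (x : List V) (b c : W) (y : List W)
      (h : shL R (a :: x) (c :: y) ∈ filFrom R (dbox d d') (a, c)
        (len d (a :: x) + len d' (c :: y)) (x.length + y.length)) :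
      cons (a, b) (shL R (a :: x) (c :: y)) ∈ filFrom R (dbox d d') (a, b)
        (len d (a :: x) + len d' (b :: c :: y)) (x.length + (c :: y).length) :=
    cons_mem_filFrom H (filFrom_mono H (v := (a, b))
      (by simp [dbox, len, hd.self, add_left_comm]) _ h)
  have left (a a' : V) (x : List V) (b : W) (y : List W)
      (h : shL R (a' :: x) (b :: y) ∈ filFrom R (dbox d d') (a', b)
        (len d (a' :: x) + len d' (b :: y)) (x.length + y.length)) :
      cons (a, b) (shL R (a' :: x) (b :: y)) ∈ filFrom R (dbox d d') (a, b)
        (len d (a :: a' :: x) + len d' (b :: y)) ((a' :: x).length + y.length) := by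
    rw [List.length_cons, Nat.add_right_comm]
    exact cons_mem_filFrom H (filFrom_mono H (v := (a, b))
      (by simp [dbox, len, hd'.self, add_assoc]) _ h)
  induction x generalizing a b y with
  | nil =>
    induction y generalizing b with
    | nil =>
      rw [shL_cons_cons]
      simp only [shL_nil_left, shL_nil_right, augL, mul_one, smul_zero, zero_add, one_smul, cons_nl]
      exact nl_mem_filFrom rfl (by simp [len, H.self])
    | cons c y ih =>
      rw [shL_cons_cons]
      simp only [shL_nil_left, augL, mul_zero, zero_smul, zero_add, add_zero, map_smul]
      exact Submodule.smul_mem _ _ (right _ _ _ _ _ (ih c))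
  | cons a' x ihx =>
    have h1 := left a a' x b y (ihx a' b y)
    induction y generalizing b with
    | nil =>
      rw [shL_cons_cons]
      simpa [augL] using h1
    | cons c y ih =>
      rw [shL_cons_cons]
      simp only [augL, mul_zero, zero_smul, add_zero, map_smul, map_add]
      exact Submodule.add_mem _ h1 (Submodule.smul_mem _ _ (right _ _ _ _ _
        (ih c (left a a' x c y (ihx a' c y)))))

theorem sh_mem_fil (hd : IsQuasiDist d) (hd' : IsQuasiDist d') {ℓ ℓ' : ℕ∞} {p q : ℕ}
    {x : NChain R V} {y : NChain R W} (hx : x ∈ fil R d ℓ p) (hy : y ∈ fil R d' ℓ' q) :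
    sh x y ∈ fil R (dbox d d') (ℓ + ℓ') (p + q) := by
  suffices Submodule.map₂ sh (fil R d ℓ p) (fil R d' ℓ' q) ≤ fil R (dbox d d') (ℓ + ℓ') (p + q) from
    this (Submodule.apply_mem_map₂ _ hx hy)
  rw [fil, fil, Submodule.map₂_span_span, Submodule.span_le]
  rintro _ ⟨_, ⟨l, h, hl, rfl⟩, _, ⟨m, h', hm, rfl⟩, rfl⟩
  obtain ⟨a, l, rfl⟩ := List.exists_cons_of_length_eq_add_one h
  obtain ⟨b, m, rfl⟩ := List.exists_cons_of_length_eq_add_one h'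
  simp only [List.length_cons, Nat.add_right_cancel_iff] at h h'
  subst h h'
  change sh _ _ ∈ _
  rw [sh_nl]
  exact filFrom_le_fil _ _ _ _ (filFrom_mono (hd.dbox hd') (v := (a, b)) (by
    simpa [(hd.dbox hd').self] using add_le_add hl hm) _ (shL_mem_filFrom hd hd' a l b m))

variable (R) in
/-- The tensors of degree `n` whose length is at most `ℓ` after prepending `v`. -/
noncomputable def tfilFrom (d : V → V → ℕ∞) (d' : W → W → ℕ∞) (v : V × W) (ℓ : ℕ∞) (n : ℕ) :
    Submodule R (NChain R V ⊗[R] NChain R W) :=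
  Submodule.span R {t | ∃ (x : List V) (b : W) (y : List W), x.length + y.length = n ∧
    len d (v.1 :: x) + (d' v.2 b + len d' (b :: y)) ≤ ℓ ∧ t = nl R (v.1 :: x) ⊗ₜ nl R (b :: y)}

theorem tfilFrom_le_tfil (d : V → V → ℕ∞) (d' : W → W → ℕ∞) (v : V × W) (ℓ : ℕ∞) (n : ℕ) :
    tfilFrom R d d' v ℓ n ≤ tfil R d d' ℓ n := by
  refine Submodule.span_le.2 ?_
  rintro _ ⟨x, b, y, h, hl, rfl⟩
  refine nl_tmul_nl_mem_tfil rfl rfl h (le_trans ?_ hl)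
  gcongr
  exact le_add_self

/-- The second factor may start at a vertex `b` other than `v.2`; charging `d' v.2 b` for it records
the part of the second coordinate that was skipped. The triangle inequality carries this charge
through the recursion. -/
theorem awL_mem_tfilFrom (hd' : IsQuasiDist d') (v : V × W)
    (l : List (V × W)) :
    awL R (v :: l) ∈ tfilFrom R d d' v (len (dbox d d') (v :: l)) l.length := by
  induction l generalizing v with
  | nil =>
    simp only [awL, List.map_nil, map_zero, add_zero]
    exact Submodule.subset_span ⟨[], v.2, [], rfl, by simp [len, hd'.self], rfl⟩
  | cons w l ih =>
    rw [awL]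
    refine Submodule.add_mem _ (Submodule.subset_span ⟨[], v.2, (w :: l).map Prod.snd, by simp, ?_,
      rfl⟩) ?_
    · rw [hd'.self, zero_add]
      rw [len, zero_add]
      exact len_map_snd_le d d' (v :: w :: l)
    · suffices tfilFrom R d d' w (len (dbox d d') (w :: l)) l.length ≤
        (tfilFrom R d d' v (len (dbox d d') (v :: w :: l)) (w :: l).length).comap
          ((cons v.1).rTensor _) from this (ih w)
      refine Submodule.span_le.2 ?_
      rintro _ ⟨x, b, y, h, hl, rfl⟩
      rw [SetLike.mem_coe, Submodule.mem_comap, LinearMap.rTensor_tmul, cons_nl]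
      refine Submodule.subset_span ⟨w.1 :: x, b, y, by simp [← h, Nat.add_right_comm], ?_, rfl⟩
      calc _ ≤ d v.1 w.1 + len d (w.1 :: x) + (d' v.2 w.2 + d' w.2 b + len d' (b :: y)) := by
            rw [len]; gcongr; exact hd'.triangle _ _ _
        _ = dbox d d' v w + (len d (w.1 :: x) + (d' w.2 b + len d' (b :: y))) := by
            rw [dbox]; ring
        _ ≤ _ := by rw [len]; gcongr

theorem aw_mem_tfil (hd' : IsQuasiDist d') {ℓ : ℕ∞} {n : ℕ}
    {z : NChain R (V × W)} (hz : z ∈ fil R (dbox d d') ℓ n) : aw z ∈ tfil R d d' ℓ n := by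
  suffices fil R (dbox d d') ℓ n ≤ (tfil R d d' ℓ n).comap aw from this hz
  refine Submodule.span_le.2 ?_
  rintro _ ⟨l, h, hl, rfl⟩
  obtain ⟨v, l, rfl⟩ := List.exists_cons_of_length_eq_add_one h
  simp only [List.length_cons, Nat.add_right_cancel_iff] at h
  subst h
  rw [SetLike.mem_coe, Submodule.mem_comap, aw_nl]
  refine tfilFrom_le_tfil d d' v _ _ (Submodule.span_mono ?_ (awL_mem_tfilFrom (d := d) hd' v l))
  rintro _ ⟨x, b, y, h, h', rfl⟩
  exact ⟨x, b, y, h, h'.trans hl, rfl⟩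

/-- A shuffle of `v.1 :: x` and `b :: y` starts at `(v.1, b)`. Reaching it from `v` costs `d' v.2
b`, which is precisely the charge built into `tfilFrom`. -/
theorem shaw_mem_filFrom (hd : IsQuasiDist d) (hd' : IsQuasiDist d') (v : V × W)
    (l : List (V × W)) :
    shaw R V W (nl R (v :: l)) ∈
      filFrom R (dbox d d') v (len (dbox d d') (v :: l)) l.length := by
  rw [shaw, LinearMap.comp_apply, aw_nl]
  suffices tfilFrom R d d' v (len (dbox d d') (v :: l)) l.length ≤
    (filFrom R (dbox d d') v (len (dbox d d') (v :: l)) l.length).comap (TensorProduct.lift sh) from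
    this (awL_mem_tfilFrom hd' v l)
  refine Submodule.span_le.2 ?_
  rintro _ ⟨x, b, y, h, hl, rfl⟩
  rw [SetLike.mem_coe, Submodule.mem_comap, TensorProduct.lift.tmul, sh_nl, ← h]
  refine filFrom_mono (hd.dbox hd') (le_trans (le_of_eq ?_) hl) _
    (shL_mem_filFrom hd hd' v.1 x b y)
  rw [dbox, hd.self, zero_add, add_left_comm]

theorem htL_mem_filFrom (hd : IsQuasiDist d) (hd' : IsQuasiDist d') (v : V × W)
    (l : List (V × W)) :
    htL R (v :: l) ∈ filFrom R (dbox d d') v (len (dbox d d') (v :: l)) (l.length + 1) := by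
  have H := hd.dbox hd'
  induction l generalizing v with
  | nil =>
    rw [htL, htL, sub_zero]
    exact cons_mem_filFrom H (shaw_mem_filFrom hd hd' v [])
  | cons w l ih =>
    rw [htL]
    exact cons_mem_filFrom H (Submodule.sub_mem _ (shaw_mem_filFrom hd hd' v _)
      (filFrom_mono H le_rfl _ (ih w)))

theorem ht_mem_fil (hd : IsQuasiDist d) (hd' : IsQuasiDist d') {ℓ : ℕ∞} {n : ℕ}
    {z : NChain R (V × W)} (hz : z ∈ fil R (dbox d d') ℓ n) :
    ht z ∈ fil R (dbox d d') ℓ (n + 1) := by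
  suffices fil R (dbox d d') ℓ n ≤ (fil R (dbox d d') ℓ (n + 1)).comap ht from this hz
  refine Submodule.span_le.2 ?_
  rintro _ ⟨l, h, hl, rfl⟩
  obtain ⟨v, l, rfl⟩ := List.exists_cons_of_length_eq_add_one h
  simp only [List.length_cons, Nat.add_right_cancel_iff] at h
  subst h
  rw [SetLike.mem_coe, Submodule.mem_comap, ht_nl]
  exact filFrom_le_fil _ _ _ _ (filFrom_mono (hd.dbox hd') (v := v) (by
    simpa [(hd.dbox hd').self] using hl) _ (htL_mem_filFrom hd hd' v l))

end Filtration
end ListChain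

namespace ListChain

/-! ### Discarding the augmentation. -/

section Reduced

variable {R : Type*} [CommRing R] {V W : Type*}

/-- Discarding the empty list. -/
noncomputable def red : NChain R V →ₗ[R] NChain R V := LinearMap.id - aug.smulRight (nl R [])

theorem red_apply (z : NChain R V) : red z = z - aug z • nl R [] := rfl

@[simp] theorem red_nl_nil : red (nl R ([] : List V)) = 0 := by simp [red_apply, augL]

theorem red_of_aug_eq_zero {z : NChain R V} (hz : aug z = 0) : red z = z := by
  simp [red_apply, hz]

theorem red_sg (z : NChain R V) : red (sg z) = sg (red z) := by simp [red_apply]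

/-- The boundary of the complex which is not augmented. -/
noncomputable def rbd : NChain R V →ₗ[R] NChain R V := red ∘ₗ bd

theorem rbd_apply (z : NChain R V) : rbd z = bd z - aug (bd z) • nl R [] := rfl

theorem rbd_red (z : NChain R V) : rbd (red z) = rbd z := by simp [rbd_apply, red_apply]

variable (R V W) in
/-- The differential of the tensor product of two complexes which are not augmented. -/
noncomputable def trbd : NChain R V ⊗[R] NChain R W →ₗ[R] NChain R V ⊗[R] NChain R W :=
  LinearMap.rTensor (NChain R W) rbd + TensorProduct.map sg (-(rbd (R := R) (V := W)))

theorem trbd_tmul (x : NChain R V) (y : NChain R W) :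
    trbd R V W (x ⊗ₜ y) = rbd x ⊗ₜ y - sg x ⊗ₜ rbd y := by
  simp [trbd, TensorProduct.tmul_neg, sub_eq_add_neg]

theorem trbd_tmul' (x : NChain R V) (y : NChain R W) :
    trbd R V W (x ⊗ₜ y) = rbd x ⊗ₜ y + (-sg x) ⊗ₜ rbd y := by
  rw [trbd_tmul, TensorProduct.neg_tmul, sub_eq_add_neg]

@[simp] theorem aug_shL (x : List V) (y : List W) : aug (shL R x y) = 0 := by
  cases x with
  | nil => simp
  | cons a x => cases y with
    | nil => simp
    | cons b y => rw [shL_cons_cons, aug_cons]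

@[simp] theorem aug_sh (x : NChain R V) (y : NChain R W) : aug (sh x y) = 0 := by
  have h : sh.compr₂ (aug (R := R) (V := V × W)) = 0 := hom_ext₂ fun l m => by simp [sh_nl]
  exact DFunLike.congr_fun (DFunLike.congr_fun h x) y

@[simp] theorem sh_red_left (x : NChain R V) (y : NChain R W) : sh (red x) y = sh x y := by
  simp [red_apply]

@[simp] theorem sh_red_right (x : NChain R V) (y : NChain R W) : sh x (red y) = sh x y := by
  simp [red_apply]

/-- The correction in `bd_sh` is a multiple of the empty list, and it is exactly the multiple that
`red` removes. -/
theorem rbd_lift_sh (t : NChain R V ⊗[R] NChain R W) :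
    rbd (TensorProduct.lift sh t) = TensorProduct.lift sh (trbd R V W t) := by
  induction t with
  | zero => simp
  | add s t hs ht => simp only [map_add, hs, ht]
  | tmul x y =>
    have h : aug (bd (sh x y)) = aug (bd x) * aug (bd y) := by
      rw [bd_sh]
      simp [augL]
    rw [trbd_tmul, map_sub, TensorProduct.lift.tmul, TensorProduct.lift.tmul,
      TensorProduct.lift.tmul, rbd_apply, h, bd_sh, rbd, LinearMap.comp_apply, sh_red_left,
      rbd, LinearMap.comp_apply, sh_red_right]
    abel

/-- Every splitting has two nonempty factors. The auxiliary `h1` treats the second factor alone,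
since in the recursion the first factor becomes nonempty only after `cons`. -/
theorem map_red_aw (z : NChain R (V × W)) : TensorProduct.map red red (aw z) = aw z := by
  have key : ∀ (v : V) (f : NChain R V →ₗ[R] NChain R V) (_ : ∀ x, f (cons v x) = cons v x)
      (t : NChain R V ⊗[R] NChain R W), TensorProduct.map f red ((cons v).rTensor _ t) =
        (cons v).rTensor _ (TensorProduct.map LinearMap.id red t) := by
    intro v f hf t
    induction t with
    | zero => simp
    | add s t hs ht => simp only [map_add, hs, ht]
    | tmul x y => simp [hf]
  have hc : ∀ (v : V) (x : NChain R V), red (cons v x) = cons v x :=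
    fun v x => red_of_aug_eq_zero (aug_cons v x)
  have h1 : TensorProduct.map LinearMap.id red ∘ₗ aw (R := R) (V := V) (W := W) = aw := by
    refine hom_ext fun l => ?_
    simp only [LinearMap.comp_apply]
    induction l with
    | nil => simp
    | cons v l ih =>
      rw [← cons_nl, aw_cons, map_add, key _ _ (fun _ => rfl), ih, TensorProduct.map_tmul,
        red_of_aug_eq_zero (aug_cons _ _)]
      rfl
  have h : TensorProduct.map red red ∘ₗ aw (R := R) (V := V) (W := W) = aw := by
    refine hom_ext fun l => ?_
    simp only [LinearMap.comp_apply]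
    cases l with
    | nil => simp
    | cons v l =>
      rw [← cons_nl, aw_cons, map_add, key _ _ (hc _), ← LinearMap.comp_apply _ aw, h1,
        TensorProduct.map_tmul, red_of_aug_eq_zero (aug_cons _ _), ← cons_nl v.1, hc]
  exact DFunLike.congr_fun h z

theorem map_red_tbd (t : NChain R V ⊗[R] NChain R W) :
    TensorProduct.map red red (tbd R V W t) = trbd R V W (TensorProduct.map red red t) := by
  induction t with
  | zero => simp
  | add s t hs ht => simp only [map_add, hs, ht]
  | tmul x y =>
    simp only [tbd_tmul, map_sub, TensorProduct.map_tmul, trbd_tmul, rbd_red, red_sg]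
    rfl

theorem trbd_aw (z : NChain R (V × W)) : trbd R V W (aw z) = aw (rbd z) := by
  have h : trbd R V W ∘ₗ aw = aw ∘ₗ rbd := by
    refine hom_ext fun l => ?_
    simp only [LinearMap.comp_apply]
    rw [← map_red_aw, ← map_red_tbd, tbd_aw, map_sub, map_add, map_red_aw, rbd_apply]
    simp
  exact DFunLike.congr_fun h z

/-- The homotopy raises degree, so it produces no single vertices and its boundary has no empty
list. Hence `red` changes nothing in `bd_ht_add_ht_bd`. -/
theorem aug_bd_ht (z : NChain R (V × W)) : aug (bd (ht z)) = 0 := by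
  have h1 : aug ∘ₗ ht (R := R) (V := V) (W := W) = 0 := hom_ext fun l => by
    cases l with
    | nil => simp
    | cons v l => rw [LinearMap.comp_apply, ← cons_nl, ht_cons, aug_cons]; rfl
  have h2 : ∀ t : NChain R V ⊗[R] NChain R W, aug (TensorProduct.lift sh t) = 0 := by
    intro t
    induction t with
    | zero => simp
    | add s t hs ht => simp only [map_add, hs, ht, add_zero]
    | tmul x y => simp
  have h : aug ∘ₗ bd ∘ₗ ht (R := R) (V := V) (W := W) = 0 := hom_ext fun l => by
    cases l with
    | nil => simp
    | cons v l =>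
      rw [LinearMap.comp_apply, LinearMap.comp_apply, ← cons_nl, ht_cons, bd_cons, map_sub,
        aug_cons, map_sub, shaw, LinearMap.comp_apply, h2]
      simpa using DFunLike.congr_fun h1 (nl R l)
  exact DFunLike.congr_fun h z

theorem rbd_ht_add_ht_rbd {z : NChain R (V × W)} (hz : aug z = 0) :
    rbd (ht z) + ht (rbd z) = shaw R V W z - z := by
  rw [rbd_apply, aug_bd_ht, rbd_apply, map_sub, map_smul, ht_nl_nil, zero_smul, smul_zero, sub_zero,
    sub_zero, bd_ht_add_ht_bd, hz, zero_smul, add_zero]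

end Reduced

/-! ### Tuples indexed by `Fin` as lists. -/

section OfFn

variable {R : Type*} [CommRing R] {V : Type*}

theorem bdL_ofFn {n : ℕ} (x : Fin (n + 1) → V) :
    bdL (List.ofFn x) = ∑ i : Fin (n + 1), (-1 : R) ^ (i : ℕ) • nl R (List.ofFn (x ∘ i.succAbove)) := by
  induction n with
  | zero => simp [bdL]
  | succ n ih =>
    conv_rhs => rw [Fin.sum_univ_succ]
    rw [List.ofFn_succ, bdL, ih, map_sum, sub_eq_add_neg, ← Finset.sum_neg_distrib]
    congr 1
    · simp [Function.comp_def]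
    · refine Finset.sum_congr rfl fun i _ => ?_
      rw [map_smul, cons_nl, List.ofFn_succ (f := x ∘ i.succ.succAbove)]
      simp [pow_succ, Function.comp_def]

theorem isChain_ofFn_iff {n : ℕ} (x : Fin (n + 1) → V) :
    (List.ofFn x).IsChain (· ≠ ·) ↔ ∀ i : Fin n, x i.castSucc ≠ x i.succ := by
  induction n with
  | zero => simp
  | succ n ih =>
    have ih := ih fun i => x i.succ
    rw [List.ofFn_succ] at ih
    rw [List.ofFn_succ, List.ofFn_succ, List.isChain_cons_cons, ih, Fin.forall_fin_succ]
    rfl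

theorem len_ofFn (d : V → V → ℕ∞) {n : ℕ} (x : Fin (n + 1) → V) :
    len d (List.ofFn x) = ∑ i : Fin n, d (x i.castSucc) (x i.succ) := by
  induction n with
  | zero => simp [len]
  | succ n ih =>
    have ih := ih fun i => x i.succ
    rw [List.ofFn_succ] at ih
    rw [List.ofFn_succ, List.ofFn_succ, len, ih, Fin.sum_univ_succ]
    rfl

theorem ofFn_get_cast {n : ℕ} (l : List V) (h : l.length = n) :
    List.ofFn (fun i : Fin n => l.get (i.cast h.symm)) = l := by
  subst h
  exact List.ofFn_get l

end OfFn

end ListChain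

namespace Digraph
open ListChain

/-! ### Distances in digraphs and box products. -/

section Dist

variable {V W : Type u} {G : Digraph V} {H : Digraph W}

theorem dist_le_of_dirPath {n : ℕ} {x y : V} (h : G.DirPath n x y) : G.dist x y ≤ n :=
  iInf₂_le n h

theorem exists_dirPath_of_dist_ne_top {x y : V} (h : G.dist x y ≠ ⊤) :
    ∃ n : ℕ, G.DirPath n x y ∧ G.dist x y = n := by
  classical
  have h' : ∃ n : ℕ, G.DirPath n x y := by
    by_contra! h'
    exact h (by simp [dist, h'])
  exact ⟨Nat.find h', Nat.find_spec h', le_antisymm (dist_le_of_dirPath (Nat.find_spec h'))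
    (le_iInf₂ fun n hn => by exact_mod_cast Nat.find_min' h' hn)⟩

theorem reachable_iff_dist_ne_top {x y : V} : G.Reachable x y ↔ G.dist x y ≠ ⊤ := by
  constructor
  · rintro ⟨n, h⟩
    exact ((dist_le_of_dirPath h).trans_lt (ENat.natCast_lt_top n)).ne
  · intro h
    obtain ⟨n, hn, -⟩ := exists_dirPath_of_dist_ne_top h
    exact ⟨n, hn⟩

variable (G) in
theorem isQuasiDist_dist : IsQuasiDist G.dist where
  self x := by simpa using dist_le_of_dirPath (.nil x)
  triangle x y z := by
    by_cases h1 : G.dist x y = ⊤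
    · simp [h1]
    by_cases h2 : G.dist y z = ⊤
    · simp [h2]
    obtain ⟨m, hm, e⟩ := exists_dirPath_of_dist_ne_top h1
    obtain ⟨n, hn, e'⟩ := exists_dirPath_of_dist_ne_top h2
    rw [e, e', ← Nat.cast_add]
    exact dist_le_of_dirPath (hm.trans hn)

theorem DirPath.map_inl {n : ℕ} {x y : V} (h : G.DirPath n x y) (b : W) :
    (G.box H).DirPath n (x, b) (y, b) := by
  induction h with
  | nil x => exact .nil _
  | cons e _ ih => 
    refine .cons ?_ ih
    exact Or.inr ⟨rfl, e⟩

theorem DirPath.map_inr {n : ℕ} {x y : W} (h : H.DirPath n x y) (a : V) :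
    (G.box H).DirPath n (a, x) (a, y) := by
  induction h with
  | nil x => exact .nil _
  | cons e _ ih => 
    refine .cons ?_ ih
    exact Or.inl ⟨rfl, e⟩

theorem DirPath.of_box {n : ℕ} {x y : V × W} (h : (G.box H).DirPath n x y) :
    ∃ i j : ℕ, i + j = n ∧ G.DirPath i x.1 y.1 ∧ H.DirPath j x.2 y.2 := by
  induction h with
  | nil x => exact ⟨0, 0, rfl, .nil _, .nil _⟩
  | cons e _ ih =>
    obtain ⟨i, j, rfl, hi, hj⟩ := ih
    rcases e with ⟨e, e'⟩ | ⟨e, e'⟩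
    · exact ⟨i, j + 1, by omega, e ▸ hi, .cons e' hj⟩
    · exact ⟨i + 1, j, by omega, .cons e' hi, e ▸ hj⟩

variable (G H) in
-- A path in the box product separates into its steps in each factor; conversely, a path in `G`
-- followed by one in `H` is a path in the product.
theorem dist_box : (G.box H).dist = dbox G.dist H.dist := by
  funext x y
  refine le_antisymm ?_ ?_
  · by_cases h1 : G.dist x.1 y.1 = ⊤
    · simp [dbox, h1]
    by_cases h2 : H.dist x.2 y.2 = ⊤
    · simp [dbox, h2]
    obtain ⟨m, hm, e⟩ := exists_dirPath_of_dist_ne_top h1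
    obtain ⟨n, hn, e'⟩ := exists_dirPath_of_dist_ne_top h2
    rw [dbox, e, e', ← Nat.cast_add]
    exact dist_le_of_dirPath ((hm.map_inl _).trans (hn.map_inr _))
  · refine le_iInf₂ fun n h => ?_
    obtain ⟨i, j, rfl, hi, hj⟩ := h.of_box
    rw [Nat.cast_add]
    exact add_le_add (dist_le_of_dirPath hi) (dist_le_of_dirPath hj)

end Dist

/-! ### The reachability complex inside the list chains. -/

section Inc

variable (R : Type u) [CommRing R] {V W : Type u}

/-- The inclusion of the reachability complex into the normalized list chains. -/
noncomputable def inc (G : Digraph V) (k : ℕ) : (G.ReachTuple k →₀ R) →ₗ[R] NChain R V :=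
  Finsupp.linearCombination R fun x => nl R (List.ofFn x.vertex)

/-- The projection from the normalized list chains onto the reachability complex. -/
noncomputable def prj (G : Digraph V) (k : ℕ) : NChain R V →ₗ[R] (G.ReachTuple k →₀ R) :=
  lift R fun l => if h : l.length = k + 1 then G.tupleChain R fun i => l.get (i.cast h.symm) else 0

variable {R}

theorem inc_single (G : Digraph V) {k : ℕ} (x : G.ReachTuple k) :
    inc R G k (Finsupp.single x 1) = nl R (List.ofFn x.vertex) := by simp [inc]

theorem inc_tupleChain (G : Digraph V) {k : ℕ} (y : Fin (k + 1) → V) (hy : G.ReachSeq y) :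
    inc R G k (G.tupleChain R y) = nl R (List.ofFn y) := by
  by_cases h : ∀ i : Fin k, y i.castSucc ≠ y i.succ
  · have := tupleChain_vertex R G ⟨y, h, hy⟩
    simp only at this
    rw [this, inc_single]
  · have h' := h
    rw [← isChain_ofFn_iff] at h'
    rw [nl_eq_zero (.of_not_isChain h'), tupleChain, dif_neg fun H => h H.1, map_zero]

theorem tupleChain_eq_zero_of_degen (G : Digraph V) {k : ℕ} {y : Fin (k + 1) → V}
    (h : Degen (List.ofFn y)) : G.tupleChain R y = 0 := by
  rw [tupleChain, dif_neg]
  intro H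
  exact h.not_isChain ((isChain_ofFn_iff y).2 H.1)

theorem prj_nl (G : Digraph V) (k : ℕ) (l : List V) :
    prj R G k (nl R l) =
      if h : l.length = k + 1 then G.tupleChain R fun i => l.get (i.cast h.symm) else 0 := by
  refine lift_nl _ (fun l hl => ?_) l
  split_ifs with h
  · exact tupleChain_eq_zero_of_degen G (by rwa [ofFn_get_cast l h])
  · rfl

theorem prj_nl_of_length_ne (G : Digraph V) {k : ℕ} {l : List V} (h : l.length ≠ k + 1) :
    prj R G k (nl R l) = 0 := by rw [prj_nl, dif_neg h]

theorem prj_nl_ofFn (G : Digraph V) {k : ℕ} (y : Fin (k + 1) → V) :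
    prj R G k (nl R (List.ofFn y)) = G.tupleChain R y := by
  rw [prj_nl, dif_pos List.length_ofFn]
  congr 1
  funext i
  rw [List.get_ofFn]
  rfl

theorem prj_inc (G : Digraph V) (k : ℕ) (a : G.ReachTuple k →₀ R) :
    prj R G k (inc R G k a) = a := by
  suffices prj R G k ∘ₗ inc R G k = LinearMap.id from DFunLike.congr_fun this a
  ext1 x
  ext1
  simp only [LinearMap.comp_apply, Finsupp.lsingle_apply, inc_single, prj_nl_ofFn,
    tupleChain_vertex, LinearMap.id_apply]

theorem inc_injective (G : Digraph V) (k : ℕ) : Function.Injective (inc R G k) :=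
  Function.LeftInverse.injective (prj_inc G k)

theorem prj_inc_of_ne (G : Digraph V) {j k : ℕ} (h : j ≠ k) (a : G.ReachTuple j →₀ R) :
    prj R G k (inc R G j a) = 0 := by
  suffices prj R G k ∘ₗ inc R G j = 0 from DFunLike.congr_fun this a
  ext1 x
  ext1
  simp only [LinearMap.comp_apply, Finsupp.lsingle_apply, inc_single]
  exact prj_nl_of_length_ne G (by simpa using h)

theorem prj_of_mem_fil_of_ne (G : Digraph V) {d : V → V → ℕ∞} {ℓ : ℕ∞} {j k : ℕ} (h : j ≠ k)
    {z : NChain R V} (hz : z ∈ fil R d ℓ j) : prj R G k z = 0 := by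
  suffices fil R d ℓ j ≤ LinearMap.ker (prj R G k) from this hz
  refine Submodule.span_le.2 ?_
  rintro _ ⟨l, h', hl, rfl⟩
  exact prj_nl_of_length_ne G (by omega)

/-- A finite sum in `ℕ∞` is finite exactly when all its terms are. This turns reachability into a
length condition, so filtration estimates also decide which chains lie in the reachability complex.
-/
theorem reachSeq_iff_len_ne_top (G : Digraph V) {k : ℕ} (y : Fin (k + 1) → V) :
    G.ReachSeq y ↔ len G.dist (List.ofFn y) ≠ ⊤ := by
  have h : ∑ i : Fin k, G.dist (y i.castSucc) (y i.succ) ≠ ⊤ ↔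
      ∀ i ∈ (Finset.univ : Finset (Fin k)), G.dist (y i.castSucc) (y i.succ) ≠ ⊤ := WithTop.sum_ne_top
  rw [len_ofFn, h]
  simp only [Finset.mem_univ, true_imp_iff, ← reachable_iff_dist_ne_top]
  rfl

/-- The bound `ℓ` is a natural number, so every list involved has finite length and is not lost by
the projection. -/
theorem inc_prj (G : Digraph V) {ℓ k : ℕ} {z : NChain R V} (hz : z ∈ fil R G.dist ℓ k) :
    inc R G k (prj R G k z) = z := by
  suffices fil R G.dist ℓ k ≤ LinearMap.eqLocus (inc R G k ∘ₗ prj R G k) LinearMap.id from this hz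
  refine Submodule.span_le.2 ?_
  rintro _ ⟨l, h, hl, rfl⟩
  obtain ⟨y, rfl⟩ : ∃ y : Fin (k + 1) → V, List.ofFn y = l :=
    ⟨_, ofFn_get_cast l h⟩
  rw [SetLike.mem_coe, LinearMap.mem_eqLocus, LinearMap.comp_apply, prj_nl_ofFn, inc_tupleChain]
  · rfl
  · rw [reachSeq_iff_len_ne_top]
    exact (hl.trans_lt (ENat.natCast_lt_top ℓ)).ne

theorem inc_boundary (G : Digraph V) (k : ℕ) (a : G.ReachTuple (k + 1) →₀ R) :
    inc R G k (G.boundary R k a) = rbd (inc R G (k + 1) a) := by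
  suffices inc R G k ∘ₗ G.boundary R k = rbd ∘ₗ inc R G (k + 1) from DFunLike.congr_fun this a
  ext1 x
  ext1
  have h1 : ∀ i : Fin (k + 2), G.ReachSeq (x.vertex ∘ i.succAbove) := fun i =>
    x.reach.comp_mono (Fin.strictMono_succAbove i).monotone
  simp only [LinearMap.comp_apply, Finsupp.lsingle_apply, inc_single]
  rw [← tupleChain_vertex, boundary_tupleChain R G _ _ x.reach, map_sum, rbd_apply, bd_nl, bdL_ofFn]
  simp [inc_tupleChain _ _ (h1 _), augL]

theorem rbd_inc_zero (G : Digraph V) (a : G.ReachTuple 0 →₀ R) : rbd (inc R G 0 a) = 0 := by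
  suffices rbd ∘ₗ inc R G 0 = 0 from DFunLike.congr_fun this a
  ext1 x
  ext1
  simp [inc_single, rbd_apply, bd_nl, bdL, augL]

theorem aug_inc (G : Digraph V) (k : ℕ) (a : G.ReachTuple k →₀ R) : aug (inc R G k a) = 0 := by
  suffices aug ∘ₗ inc R G k = 0 from DFunLike.congr_fun this a
  ext1 x
  ext1
  simp [inc_single, augL]

theorem sg_inc (G : Digraph V) (k : ℕ) (a : G.ReachTuple k →₀ R) :
    sg (inc R G k a) = (-1 : R) ^ (k + 1) • inc R G k a := by
  suffices sg ∘ₗ inc R G k = (-1 : R) ^ (k + 1) • inc R G k from DFunLike.congr_fun this a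
  ext1 x
  ext1
  simp [inc_single]

theorem inc_mapChain {G : Digraph V} {H : Digraph W} (f : Hom G H) (k : ℕ)
    (a : G.ReachTuple k →₀ R) : inc R H k (mapChain R f k a) = nmap f.toFun (inc R G k a) := by
  suffices inc R H k ∘ₗ mapChain R f k = nmap f.toFun ∘ₗ inc R G k from DFunLike.congr_fun this a
  ext1 x
  ext1
  simp only [LinearMap.comp_apply, Finsupp.lsingle_apply]
  rw [inc_single, ← tupleChain_vertex, mapChain_tupleChain R f _ _ x.reach,
    inc_tupleChain _ _ (x.reach.map f), nmap_nl, List.map_ofFn]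

variable (R) in
/-- The length filtration, on the free module on the generators. -/
noncomputable def gfil (G : Digraph V) (ℓ k : ℕ) : Submodule R (G.ReachTuple k →₀ R) :=
  Submodule.span R {c | ∃ x : G.ReachTuple k, x.length ≤ (ℓ : ℕ∞) ∧ c = Finsupp.single x 1}

theorem inc_mem_fil (G : Digraph V) {ℓ k : ℕ} {a : G.ReachTuple k →₀ R} (ha : a ∈ gfil R G ℓ k) :
    inc R G k a ∈ fil R G.dist ℓ k := by
  suffices gfil R G ℓ k ≤ (fil R G.dist ℓ k).comap (inc R G k) from this ha
  refine Submodule.span_le.2 ?_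
  rintro _ ⟨x, hx, rfl⟩
  rw [SetLike.mem_coe, Submodule.mem_comap, inc_single]
  exact nl_mem_fil (by simp) ((len_ofFn _ _).trans_le hx)

theorem prj_mem_gfil (G : Digraph V) {ℓ k : ℕ} {z : NChain R V}
    (hz : z ∈ fil R G.dist ℓ k) : prj R G k z ∈ gfil R G ℓ k := by
  suffices fil R G.dist ℓ k ≤ (gfil R G ℓ k).comap (prj R G k) from this hz
  refine Submodule.span_le.2 ?_
  rintro _ ⟨l, h, hl, rfl⟩
  obtain ⟨y, rfl⟩ : ∃ y : Fin (k + 1) → V, List.ofFn y = l := ⟨_, ofFn_get_cast l h⟩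
  rw [SetLike.mem_coe, Submodule.mem_comap, prj_nl_ofFn, tupleChain]
  split_ifs with h
  · exact Submodule.subset_span ⟨⟨y, h.1, h.2⟩, (len_ofFn _ _).symm.trans_le hl, rfl⟩
  · exact Submodule.zero_mem _

theorem gfil_mono (G : Digraph V) {ℓ ℓ' : ℕ} (h : ℓ ≤ ℓ') (k : ℕ) :
    gfil R G ℓ k ≤ gfil R G ℓ' k := by
  refine Submodule.span_mono ?_
  rintro _ ⟨x, hx, rfl⟩
  exact ⟨x, hx.trans (by exact_mod_cast h), rfl⟩

theorem exists_mem_gfil (G : Digraph V) (k : ℕ) (a : G.ReachTuple k →₀ R) :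
    ∃ ℓ, a ∈ gfil R G ℓ k := by
  induction a using Finsupp.induction_linear with
  | zero => exact ⟨0, Submodule.zero_mem _⟩
  | add a b ha hb =>
    obtain ⟨ℓ, ha⟩ := ha
    obtain ⟨ℓ', hb⟩ := hb
    exact ⟨max ℓ ℓ', Submodule.add_mem _ (gfil_mono G (le_max_left _ _) k ha)
      (gfil_mono G (le_max_right _ _) k hb)⟩
  | single x r =>
    have hx := (reachSeq_iff_len_ne_top G x.vertex).1 x.reach
    rw [len_ofFn] at hx
    obtain ⟨n, hn⟩ := ENat.ne_top_iff_exists.1 hx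
    refine ⟨n, ?_⟩
    have : Finsupp.single x r = r • (Finsupp.single x 1 : G.ReachTuple k →₀ R) := by simp
    rw [this]
    exact Submodule.smul_mem _ _ (Submodule.subset_span ⟨x, hn.ge, rfl⟩)

end Inc

end Digraph

namespace Digraph

/-! ### Elementwise access to the tensor product of chain complexes. -/

section TensorComplex

variable {R : Type u} [CommRing R] {A B A' B' : ChainComplex (ModuleCat.{u} R) ℕ}
  {M : Type u} [AddCommGroup M] [Module R M]

theorem tensorObj_hom_ext {n : ℕ} {f g : (HomologicalComplex.tensorObj A B).X n →ₗ[R] M}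
    (h : ∀ (p q : ℕ) (h : p + q = n) (a : A.X p) (b : B.X q),
      f (tensorElt h a b) = g (tensorElt h a b)) : f = g := by
  have : ModuleCat.ofHom f = ModuleCat.ofHom g := by
    apply HomologicalComplex.mapBifunctor.hom_ext
    intro p q hpq
    apply ModuleCat.hom_ext
    apply TensorProduct.ext'
    intro a b
    exact h p q hpq a b
  exact congrArg ModuleCat.Hom.hom this

/-- The linear map on the tensor product of two complexes with prescribed values. -/
noncomputable def tensorLift {n : ℕ} (f : ∀ p q : ℕ, A.X p →ₗ[R] B.X q →ₗ[R] M) :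
    (HomologicalComplex.tensorObj A B).X n →ₗ[R] M :=
  (HomologicalComplex.mapBifunctorDesc (A := ModuleCat.of R M) fun p q _ =>
    ModuleCat.ofHom (TensorProduct.lift (f p q))).hom

theorem tensorLift_tensorElt {n : ℕ} (f : ∀ p q : ℕ, A.X p →ₗ[R] B.X q →ₗ[R] M) {p q : ℕ}
    (h : p + q = n) (a : A.X p) (b : B.X q) :
    tensorLift f (tensorElt h a b) = f p q a b := by
  have := HomologicalComplex.ι_mapBifunctorDesc (K₁ := A) (K₂ := B) (A := ModuleCat.of R M)
    (F := MonoidalCategory.curriedTensor (ModuleCat R)) (c := ComplexShape.down ℕ)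
    (fun p q (_ : _ = n) => ModuleCat.ofHom (TensorProduct.lift (f p q))) p q h
  exact congrArg (fun φ => φ.hom (a ⊗ₜ[R] b)) this

/-- The inclusion of a summand of the tensor product of two complexes. -/
noncomputable def tensorIncl {p q n : ℕ} (h : p + q = n) :
    (A.X p : Type u) ⊗[R] (B.X q : Type u) →ₗ[R] (HomologicalComplex.tensorObj A B).X n :=
  (HomologicalComplex.ιTensorObj A B p q n h).hom

theorem tensorIncl_tmul {p q n : ℕ} (h : p + q = n) (a : A.X p) (b : B.X q) :
    tensorIncl h (a ⊗ₜ[R] b) = tensorElt h a b := rfl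

theorem tensorHom_tensorElt (f : A ⟶ A') (g : B ⟶ B') {p q n : ℕ} (h : p + q = n) (a : A.X p)
    (b : B.X q) : ((HomologicalComplex.tensorHom f g).f n).hom (tensorElt h a b) =
      tensorElt h ((f.f p).hom a) ((g.f q).hom b) := by
  have := HomologicalComplex.ι_mapBifunctorMap f g
    (MonoidalCategory.curriedTensor (ModuleCat R)) (ComplexShape.down ℕ) p q n h
  exact congrArg (fun φ => φ.hom (a ⊗ₜ[R] b)) this

open HomologicalComplex in
theorem d_tensorElt {p q n m : ℕ} (h : p + q = n) (a : A.X p) (b : B.X q) :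
    ((tensorObj A B).d n m).hom (tensorElt h a b) =
      (mapBifunctor.d₁ A B (MonoidalCategory.curriedTensor (ModuleCat R)) (ComplexShape.down ℕ)
        p q m).hom (a ⊗ₜ[R] b) +
      (mapBifunctor.d₂ A B (MonoidalCategory.curriedTensor (ModuleCat R)) (ComplexShape.down ℕ)
        p q m).hom (a ⊗ₜ[R] b) := by
  have h1 := mapBifunctor.ι_D₁ A B (MonoidalCategory.curriedTensor (ModuleCat R))
    (ComplexShape.down ℕ) n m p q h
  have h2 := mapBifunctor.ι_D₂ A B (MonoidalCategory.curriedTensor (ModuleCat R))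
    (ComplexShape.down ℕ) n m p q h
  rw [← h1, ← h2]
  rfl

open HomologicalComplex in
theorem tensor_d₁_succ {p q n : ℕ} (h : p + q = n) (a : A.X (p + 1)) (b : B.X q) :
    (mapBifunctor.d₁ A B (MonoidalCategory.curriedTensor (ModuleCat R)) (ComplexShape.down ℕ)
      (p + 1) q n).hom (a ⊗ₜ[R] b) = tensorElt h ((A.d (p + 1) p).hom a) b := by
  rw [mapBifunctor.d₁_eq A B _ (ComplexShape.down ℕ) (i₁ := p + 1) (i₁' := p) rfl q n h]
  erw [one_smul]
  rfl

open HomologicalComplex in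
theorem tensor_d₁_zero {q n : ℕ} (t) :
    (mapBifunctor.d₁ A B (MonoidalCategory.curriedTensor (ModuleCat R)) (ComplexShape.down ℕ)
      0 q n).hom t = 0 := by
  rw [mapBifunctor.d₁_eq_zero]
  · rfl
  · simp

open HomologicalComplex in
theorem tensor_d₂_succ {p q n : ℕ} (h : p + q = n) (a : A.X p) (b : B.X (q + 1)) :
    (mapBifunctor.d₂ A B (MonoidalCategory.curriedTensor (ModuleCat R)) (ComplexShape.down ℕ)
      p (q + 1) n).hom (a ⊗ₜ[R] b) = (-1 : R) ^ p • tensorElt h a ((B.d (q + 1) q).hom b) := by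
  rw [mapBifunctor.d₂_eq A B _ (ComplexShape.down ℕ) p (i₂ := q + 1) (i₂' := q) rfl n h]
  have hε : ComplexShape.ε₂ (ComplexShape.down ℕ) (ComplexShape.down ℕ) (ComplexShape.down ℕ)
    (p, q + 1) = (-1) ^ p := rfl
  rw [hε]
  -- One sign lives in `ℤˣ` and the other in `R`; splitting by parity avoids comparing the two
  -- actions.
  rcases Nat.even_or_odd p with hp | hp
  · rw [hp.neg_one_pow, hp.neg_one_pow, one_smul, one_smul]
    rfl
  · rw [hp.neg_one_pow, hp.neg_one_pow, Units.neg_smul, one_smul, neg_one_smul]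
    rfl

open HomologicalComplex in
theorem tensor_d₂_zero {p n : ℕ} (t) :
    (mapBifunctor.d₂ A B (MonoidalCategory.curriedTensor (ModuleCat R)) (ComplexShape.down ℕ)
      p 0 n).hom t = 0 := by
  rw [mapBifunctor.d₂_eq_zero]
  · rfl
  · simp

end TensorComplex

/-! ### Transport to the reachability complexes. -/

section Comparison

open HomologicalComplex ListChain

variable (R : Type u) [CommRing R] {V W V' W' : Type u} (G : Digraph V) (H : Digraph W)

theorem RC_d (k : ℕ) (a : G.ReachTuple (k + 1) →₀ R) :
    ((G.RC R).d (k + 1) k).hom (a : (G.RC R).X (k + 1)) = G.boundary R k a := by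
  have h : (G.RC R).d (k + 1) k = ModuleCat.ofHom (G.boundary R k) := by
    simp only [RC, ChainComplex.of_d]
  rw [h]
  rfl

/-- The inclusion of the reachability complex into the normalized list chains. -/
noncomputable def rcInc (k : ℕ) : (G.RC R).X k →ₗ[R] NChain R V := inc R G k

/-- The projection from the normalized list chains onto the reachability complex. -/
noncomputable def rcPrj (k : ℕ) : NChain R V →ₗ[R] (G.RC R).X k := prj R G k

variable {R}

theorem rcPrj_rcInc (k : ℕ) (a : (G.RC R).X k) : rcPrj R G k (rcInc R G k a) = a := prj_inc G k a

theorem rcInc_injective (k : ℕ) : Function.Injective (rcInc R G k) := inc_injective G k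

theorem rcPrj_rcInc_of_ne {j k : ℕ} (h : j ≠ k) (a : (G.RC R).X j) :
    rcPrj R G k (rcInc R G j a) = 0 := prj_inc_of_ne G h a

theorem rcInc_rcPrj {ℓ k : ℕ} {z : NChain R V} (hz : z ∈ fil R G.dist ℓ k) :
    rcInc R G k (rcPrj R G k z) = z := inc_prj G hz

theorem rcInc_mem_fil {ℓ k : ℕ} {a : (G.RC R).X k} (ha : a ∈ G.lengthFil R ℓ k) :
    rcInc R G k a ∈ fil R G.dist ℓ k := inc_mem_fil G ha

theorem rcPrj_mem_lengthFil {ℓ k : ℕ} {z : NChain R V} (hz : z ∈ fil R G.dist ℓ k) :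
    rcPrj R G k z ∈ G.lengthFil R ℓ k := prj_mem_gfil G hz

theorem exists_mem_lengthFil (k : ℕ) (a : (G.RC R).X k) : ∃ ℓ, a ∈ G.lengthFil R ℓ k :=
  exists_mem_gfil G k a

theorem rcInc_d (k : ℕ) (a : (G.RC R).X (k + 1)) :
    rcInc R G k (((G.RC R).d (k + 1) k).hom a) = rbd (rcInc R G (k + 1) a) := by
  erw [RC_d]
  exact inc_boundary G k a

theorem rbd_rcInc_zero (a : (G.RC R).X 0) : rbd (rcInc R G 0 a) = 0 := rbd_inc_zero G a

theorem aug_rcInc (k : ℕ) (a : (G.RC R).X k) : aug (rcInc R G k a) = 0 := aug_inc G k a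

theorem sg_rcInc (k : ℕ) (a : (G.RC R).X k) :
    sg (rcInc R G k a) = (-1 : R) ^ (k + 1) • rcInc R G k a := sg_inc G k a

theorem rcInc_RCmap {G : Digraph V} {H : Digraph W} (f : Hom G H) (k : ℕ) (a : (G.RC R).X k) :
    rcInc R H k (((RCmap R f).f k).hom a) = nmap f.toFun (rcInc R G k a) := inc_mapChain f k a

theorem rcInc_gen {k : ℕ} (x : G.ReachTuple k) :
    rcInc R G k (x.gen R) = nl R (List.ofFn x.vertex) := inc_single G x

variable (R)

/-- The inclusion of the tensor product of two reachability complexes into the tensor product of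
the modules of normalized list chains. -/
noncomputable def tInc (n : ℕ) :
    (tensorObj (G.RC R) (H.RC R)).X n →ₗ[R] NChain R V ⊗[R] NChain R W :=
  tensorLift (M := NChain R V ⊗[R] NChain R W) fun p q => (TensorProduct.mk R _ _).compl₁₂ (rcInc R G p) (rcInc R H q)

/-- The projection from the tensor product of the modules of normalized list chains onto the
tensor product of two reachability complexes. -/
noncomputable def tPrj (n : ℕ) :
    NChain R V ⊗[R] NChain R W →ₗ[R] (tensorObj (G.RC R) (H.RC R)).X n :=
  ∑ a : Finset.HasAntidiagonal.antidiagonal n, tensorIncl (Finset.HasAntidiagonal.mem_antidiagonal.1 a.2) ∘ₗ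
    TensorProduct.map (rcPrj R G a.1.1) (rcPrj R H a.1.2)

variable {R}

theorem tInc_tensorElt {p q n : ℕ} (h : p + q = n) (a : (G.RC R).X p) (b : (H.RC R).X q) :
    tInc R G H n (tensorElt h a b) = rcInc R G p a ⊗ₜ rcInc R H q b := by
  rw [tInc, tensorLift_tensorElt]
  rfl

theorem tensorElt_zero_left {A B : ChainComplex (ModuleCat.{u} R) ℕ} {p q n : ℕ} (h : p + q = n)
    (b : B.X q) : tensorElt h (0 : A.X p) b = 0 := by
  rw [← tensorIncl_tmul, TensorProduct.zero_tmul, map_zero]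

theorem tPrj_tmul (n : ℕ) (x : NChain R V) (y : NChain R W) :
    tPrj R G H n (x ⊗ₜ y) = ∑ a : Finset.HasAntidiagonal.antidiagonal n,
      tensorElt (Finset.HasAntidiagonal.mem_antidiagonal.1 a.2) (rcPrj R G a.1.1 x) (rcPrj R H a.1.2 y) := by
  simp only [tPrj, LinearMap.sum_apply, LinearMap.comp_apply, TensorProduct.map_tmul,
    tensorIncl_tmul]

/-- If `x` is concentrated in degree `p`, the total degree leaves only one possible summand. -/
theorem tPrj_tmul_eq {p q n : ℕ} (h : p + q = n) (x : NChain R V) (y : NChain R W)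
    (hx : ∀ p', p' ≠ p → rcPrj R G p' x = 0) :
    tPrj R G H n (x ⊗ₜ y) = tensorElt h (rcPrj R G p x) (rcPrj R H q y) := by
  rw [tPrj_tmul, Finset.sum_eq_single ⟨(p, q), Finset.HasAntidiagonal.mem_antidiagonal.2 h⟩]
  · rintro ⟨⟨p', q'⟩, h'⟩ - hne
    have h' := Finset.HasAntidiagonal.mem_antidiagonal.1 h'
    rw [hx p', tensorElt_zero_left]
    rintro rfl
    exact hne (by simp; omega)
  · simp

theorem tPrj_tInc (n : ℕ) (t : (tensorObj (G.RC R) (H.RC R)).X n) :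
    tPrj R G H n (tInc R G H n t) = t := by
  suffices tPrj R G H n ∘ₗ tInc R G H n = LinearMap.id from DFunLike.congr_fun this t
  refine tensorObj_hom_ext fun p q h a b => ?_
  rw [LinearMap.comp_apply, tInc_tensorElt, tPrj_tmul_eq G H h _ _
    (fun p' hp => rcPrj_rcInc_of_ne G hp.symm a), rcPrj_rcInc, rcPrj_rcInc]
  rfl

theorem tInc_injective (n : ℕ) : Function.Injective (tInc R G H n) :=
  Function.LeftInverse.injective (tPrj_tInc G H n)

theorem tInc_d (n : ℕ) (t : (tensorObj (G.RC R) (H.RC R)).X (n + 1)) :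
    tInc R G H n (((tensorObj (G.RC R) (H.RC R)).d (n + 1) n).hom t) =
      trbd R V W (tInc R G H (n + 1) t) := by
  suffices tInc R G H n ∘ₗ ((tensorObj (G.RC R) (H.RC R)).d (n + 1) n).hom =
      trbd R V W ∘ₗ tInc R G H (n + 1) from DFunLike.congr_fun this t
  refine tensorObj_hom_ext (M := NChain R _ ⊗[R] NChain R _) fun p q h a b => ?_
  rw [LinearMap.comp_apply, LinearMap.comp_apply, tInc_tensorElt, d_tensorElt, map_add, trbd_tmul']
  congr 1
  · cases p with
    | zero => rw [tensor_d₁_zero, rbd_rcInc_zero, map_zero, TensorProduct.zero_tmul]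
    | succ p => rw [tensor_d₁_succ (by omega), tInc_tensorElt, rcInc_d]
  · cases q with
    | zero => rw [tensor_d₂_zero, rbd_rcInc_zero, map_zero, TensorProduct.tmul_zero]
    | succ q =>
      rw [tensor_d₂_succ (by omega), map_smul, tInc_tensorElt, rcInc_d, sg_rcInc, pow_succ,
        TensorProduct.smul_tmul', mul_neg_one, neg_smul, neg_neg]

theorem tInc_tensorHom {G : Digraph V} {G' : Digraph V'} {H : Digraph W} {H' : Digraph W'}
    (f : Hom G G') (g : Hom H H') (n : ℕ) (t : (tensorObj (G.RC R) (H.RC R)).X n) :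
    tInc R G' H' n (((tensorHom (RCmap R f) (RCmap R g)).f n).hom t) =
      TensorProduct.map (nmap f.toFun) (nmap g.toFun) (tInc R G H n t) := by
  suffices tInc R G' H' n ∘ₗ ((tensorHom (RCmap R f) (RCmap R g)).f n).hom =
      TensorProduct.map (nmap f.toFun) (nmap g.toFun) ∘ₗ tInc R G H n from
    DFunLike.congr_fun this t
  refine tensorObj_hom_ext (M := NChain R _ ⊗[R] NChain R _) fun p q h a b => ?_
  rw [LinearMap.comp_apply, LinearMap.comp_apply, tInc_tensorElt, tensorHom_tensorElt,
    tInc_tensorElt, rcInc_RCmap, rcInc_RCmap, TensorProduct.map_tmul]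

/-- Both claims are linear in `t` and need checking only on pairs of lists. A finite total length
forces both lengths to be finite, so both lists give chains of the reachability complexes. -/
theorem tInc_tPrj_and_tPrj_mem {ℓ n : ℕ} {t : NChain R V ⊗[R] NChain R W}
    (ht : t ∈ tfil R G.dist H.dist ℓ n) :
    tInc R G H n (tPrj R G H n t) = t ∧
      tPrj R G H n t ∈ tensorFil (G.lengthFil R) (H.lengthFil R) ℓ n := by
  suffices tfil R G.dist H.dist ℓ n ≤
      LinearMap.eqLocus (tInc R G H n ∘ₗ tPrj R G H n) LinearMap.id ⊓
        (tensorFil (G.lengthFil R) (H.lengthFil R) ℓ n).comap (tPrj R G H n) from this ht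
  refine Submodule.span_le.2 ?_
  rintro _ ⟨p, q, x, y, hx, hy, hn, hl, rfl⟩
  have hl' := hl.trans_lt (ENat.natCast_lt_top ℓ)
  obtain ⟨s, hs⟩ := ENat.ne_top_iff_exists.1 (WithTop.add_lt_top.1 hl').1.ne
  obtain ⟨s', hs'⟩ := ENat.ne_top_iff_exists.1 (WithTop.add_lt_top.1 hl').2.ne
  rw [← hs, ← hs'] at hl
  have hle : s + s' ≤ ℓ := by exact_mod_cast hl
  have h1 : nl R x ∈ fil R G.dist s p := nl_mem_fil hx hs.ge
  -- The tensor filtration asks for levels with sum exactly `ℓ`, so the second factor absorbs the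
  -- slack.
  have h2 : nl R y ∈ fil R H.dist (ℓ - s : ℕ) q :=
    nl_mem_fil hy (hs'.ge.trans (by exact_mod_cast (by omega : s' ≤ ℓ - s)))
  have e := tPrj_tmul_eq G H hn (nl R x) (nl R y)
    (fun p' hp' => prj_nl_of_length_ne G (by omega))
  refine ⟨?_, ?_⟩
  · change tInc R G H n (tPrj R G H n _) = _
    rw [e, tInc_tensorElt, rcInc_rcPrj G h1, rcInc_rcPrj H h2]
    rfl
  · rw [Submodule.comap_coe, Set.mem_preimage, e]
    exact Submodule.subset_span ⟨s, ℓ - s, p, q, by omega, hn, _, rcPrj_mem_lengthFil G h1, _,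
      rcPrj_mem_lengthFil H h2, rfl⟩

theorem lift_sh_tInc_mem_fil {ℓ n : ℕ} {t : (tensorObj (G.RC R) (H.RC R)).X n}
    (ht : t ∈ tensorFil (G.lengthFil R) (H.lengthFil R) ℓ n) :
    TensorProduct.lift sh (tInc R G H n t) ∈ fil R (G.box H).dist ℓ n := by
  suffices tensorFil (G.lengthFil R) (H.lengthFil R) ℓ n ≤
      (fil R (G.box H).dist ℓ n).comap (TensorProduct.lift sh ∘ₗ tInc R G H n) from this ht
  refine Submodule.span_le.2 ?_
  rintro _ ⟨s, s', p, q, rfl, rfl, a, ha, b, hb, rfl⟩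
  rw [SetLike.mem_coe, Submodule.mem_comap, LinearMap.comp_apply, tInc_tensorElt, TensorProduct.lift.tmul, dist_box, Nat.cast_add]
  exact sh_mem_fil (isQuasiDist_dist G) (isQuasiDist_dist H) (rcInc_mem_fil G ha)
    (rcInc_mem_fil H hb)

theorem exists_mem_fil_lift_sh_tInc (n : ℕ) (t : (tensorObj (G.RC R) (H.RC R)).X n) :
    ∃ ℓ : ℕ, TensorProduct.lift sh (tInc R G H n t) ∈ fil R (G.box H).dist ℓ n := by
  let S : ℕ → Submodule R ((tensorObj (G.RC R) (H.RC R)).X n) := fun ℓ =>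
    (fil R (G.box H).dist ℓ n).comap (TensorProduct.lift sh ∘ₗ tInc R G H n)
  have hS : Monotone S := fun ℓ ℓ' h => Submodule.comap_mono (Submodule.span_mono (by
    rintro _ ⟨l, h1, h2, rfl⟩
    exact ⟨l, h1, h2.trans (by exact_mod_cast h), rfl⟩))
  -- Linear maps out of the tensor complex are determined on elementary tensors. Applied to the
  -- quotient by the union of the `S ℓ`, this shows that every element lies in some `S ℓ`.
  have key : (⨆ ℓ, S ℓ).mkQ = 0 := by
    refine tensorObj_hom_ext fun p q h a b => ?_
    rw [LinearMap.zero_apply, Submodule.mkQ_apply, Submodule.Quotient.mk_eq_zero]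
    obtain ⟨s, ha⟩ := exists_mem_lengthFil G p a
    obtain ⟨s', hb⟩ := exists_mem_lengthFil H q b
    exact Submodule.mem_iSup_of_mem (s + s') (lift_sh_tInc_mem_fil G H
      (Submodule.subset_span ⟨s, s', p, q, rfl, h, a, ha, b, hb, rfl⟩))
  have ht : t ∈ ⨆ ℓ, S ℓ := by
    rw [← Submodule.Quotient.mk_eq_zero, ← Submodule.mkQ_apply, key, LinearMap.zero_apply]
  exact (Submodule.mem_iSup_of_directed _ hS.directed_le).1 ht

variable (R) in
/-- The shuffle map in degree `n`. -/
noncomputable def shuffleHom (n : ℕ) :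
    (tensorObj (G.RC R) (H.RC R)).X n →ₗ[R] ((G.box H).RC R).X n :=
  rcPrj R (G.box H) n ∘ₗ TensorProduct.lift sh ∘ₗ tInc R G H n

variable (R) in
/-- The Alexander–Whitney map in degree `n`. -/
noncomputable def awHom (n : ℕ) :
    ((G.box H).RC R).X n →ₗ[R] (tensorObj (G.RC R) (H.RC R)).X n :=
  tPrj R G H n ∘ₗ aw ∘ₗ rcInc R (G.box H) n

variable (R) in
/-- The component from degree `i` to degree `j` of the homotopy. -/
noncomputable def htHom (i j : ℕ) : ((G.box H).RC R).X i →ₗ[R] ((G.box H).RC R).X j :=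
  rcPrj R (G.box H) j ∘ₗ ht ∘ₗ rcInc R (G.box H) i

/-- The projection in `shuffleHom` loses nothing, because the shuffle has finite length. With
injectivity of `rcInc`, this reduces identities for `shuffleHom` to identities between list chains.
-/
theorem rcInc_shuffleHom (n : ℕ) (t : (tensorObj (G.RC R) (H.RC R)).X n) :
    rcInc R (G.box H) n (shuffleHom R G H n t) = TensorProduct.lift sh (tInc R G H n t) := by
  obtain ⟨ℓ, h⟩ := exists_mem_fil_lift_sh_tInc G H n t
  exact rcInc_rcPrj _ h

theorem aw_rcInc_mem_tfil {ℓ n : ℕ} {z : ((G.box H).RC R).X n}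
    (hz : z ∈ (G.box H).lengthFil R ℓ n) :
    aw (rcInc R (G.box H) n z) ∈ tfil R G.dist H.dist ℓ n := by
  have h := rcInc_mem_fil _ hz
  rw [dist_box] at h
  exact aw_mem_tfil (isQuasiDist_dist H) h

theorem ht_rcInc_mem_fil {ℓ n : ℕ} {z : ((G.box H).RC R).X n}
    (hz : z ∈ (G.box H).lengthFil R ℓ n) :
    ht (rcInc R (G.box H) n z) ∈ fil R (G.box H).dist ℓ (n + 1) := by
  have h := rcInc_mem_fil _ hz
  rw [dist_box] at h ⊢
  exact ht_mem_fil (isQuasiDist_dist G) (isQuasiDist_dist H) h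

theorem tInc_awHom (n : ℕ) (z : ((G.box H).RC R).X n) :
    tInc R G H n (awHom R G H n z) = aw (rcInc R (G.box H) n z) := by
  obtain ⟨ℓ, h⟩ := exists_mem_lengthFil _ n z
  exact (tInc_tPrj_and_tPrj_mem G H (aw_rcInc_mem_tfil G H h)).1

theorem rcInc_htHom (n : ℕ) (z : ((G.box H).RC R).X n) :
    rcInc R (G.box H) (n + 1) (htHom R G H n (n + 1) z) = ht (rcInc R (G.box H) n z) := by
  obtain ⟨ℓ, h⟩ := exists_mem_lengthFil _ n z
  exact rcInc_rcPrj _ (ht_rcInc_mem_fil G H h)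

/-- `ht` raises degree by exactly one, so projecting its values to any other degree gives zero. -/
theorem htHom_eq_zero {i j : ℕ} (hij : i + 1 ≠ j) : htHom R G H i j = 0 := by
  ext1 z
  obtain ⟨ℓ, h⟩ := exists_mem_lengthFil _ i z
  exact prj_of_mem_fil_of_ne _ hij (ht_rcInc_mem_fil G H h)

variable (R) in
/-- The shuffle map. -/
noncomputable def shuffle : tensorObj (G.RC R) (H.RC R) ⟶ (G.box H).RC R :=
  ChainComplex.ofHom (fun n => ModuleCat.ofHom (shuffleHom R G H n)) fun n => by
    ext t
    apply rcInc_injective (R := R) (G.box H) n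
    change rcInc R (G.box H) n ((((G.box H).RC R).d (n + 1) n).hom (shuffleHom R G H (n + 1) t)) =
      rcInc R (G.box H) n (shuffleHom R G H n
        (((tensorObj (G.RC R) (H.RC R)).d (n + 1) n).hom t))
    rw [rcInc_d, rcInc_shuffleHom, rcInc_shuffleHom, tInc_d, rbd_lift_sh]

variable (R) in
/-- The Alexander–Whitney map. -/
noncomputable def alexanderWhitney : (G.box H).RC R ⟶ tensorObj (G.RC R) (H.RC R) :=
  ChainComplex.ofHom (fun n => ModuleCat.ofHom (awHom R G H n)) fun n => by
    ext z
    apply tInc_injective (R := R) G H n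
    change tInc R G H n (((tensorObj (G.RC R) (H.RC R)).d (n + 1) n).hom (awHom R G H (n + 1) z)) =
      tInc R G H n (awHom R G H n ((((G.box H).RC R).d (n + 1) n).hom z))
    rw [tInc_d, tInc_awHom, tInc_awHom, rcInc_d, trbd_aw]

/-- An equality, not merely a homotopy: chains in the reachability complex have no empty-list
component, so both corrections in `aw_sh` vanish. -/
theorem shuffle_comp_alexanderWhitney :
    shuffle R G H ≫ alexanderWhitney R G H = 𝟙 _ := by
  ext n : 1
  apply ModuleCat.hom_ext
  change awHom R G H n ∘ₗ shuffleHom R G H n = LinearMap.id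
  refine tensorObj_hom_ext fun p q h a b => ?_
  apply tInc_injective
  rw [LinearMap.comp_apply, tInc_awHom, rcInc_shuffleHom, LinearMap.id_apply, tInc_tensorElt,
    TensorProduct.lift.tmul, aw_sh, aug_rcInc, aug_rcInc, zero_smul, zero_smul, sub_zero, sub_zero]

theorem homotopy_comm (n : ℕ) (z : ((G.box H).RC R).X n) :
    rcInc R (G.box H) n (shuffleHom R G H n (awHom R G H n z)) =
      ht (rbd (rcInc R (G.box H) n z)) + rbd (ht (rcInc R (G.box H) n z)) +
        rcInc R (G.box H) n z := by
  rw [rcInc_shuffleHom, tInc_awHom, add_comm (ht _), rbd_ht_add_ht_rbd (aug_rcInc _ _ _), shaw,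
    LinearMap.comp_apply, sub_add_cancel]

variable (R) in
/-- The component from degree `i` to degree `j` of the homotopy, as a morphism. -/
noncomputable def htMor (i j : ℕ) : ((G.box H).RC R).X i ⟶ ((G.box H).RC R).X j :=
  ModuleCat.ofHom (htHom R G H i j)

variable (R) in
/-- The homotopy from the composite of the Alexander–Whitney map and the shuffle map to the
identity. -/
noncomputable def shuffleHomotopy :
    Homotopy (alexanderWhitney R G H ≫ shuffle R G H) (𝟙 ((G.box H).RC R)) where
  hom i j := htMor R G H i j
  zero i j h := by
    apply ModuleCat.hom_ext
    exact htHom_eq_zero G H (fun h' => h h')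
  comm n := by
    apply ModuleCat.hom_ext
    ext1 z
    apply rcInc_injective
    cases n with
    | zero =>
      rw [Homotopy.dNext_zero_chainComplex, Homotopy.prevD_chainComplex, zero_add]
      refine (homotopy_comm G H 0 z).trans ?_
      rw [rbd_rcInc_zero, map_zero, zero_add, ← rcInc_htHom, ← rcInc_d, ← map_add]
      rfl
    | succ n =>
      rw [Homotopy.dNext_succ_chainComplex, Homotopy.prevD_chainComplex]
      refine (homotopy_comm G H (n + 1) z).trans ?_
      rw [← rcInc_htHom, ← rcInc_d, ← rcInc_d, ← rcInc_htHom, ← map_add, ← map_add]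
      rfl

variable (R) in
/-- The homotopy equivalence between the tensor product of the reachability complexes of two
directed graphs and the reachability complex of their box product. -/
noncomputable def eilenbergZilber :
    HomotopyEquiv (tensorObj (G.RC R) (H.RC R)) ((G.box H).RC R) where
  hom := shuffle R G H
  inv := alexanderWhitney R G H
  homotopyHomInvId := Homotopy.ofEq (shuffle_comp_alexanderWhitney G H)
  homotopyInvHomId := shuffleHomotopy R G H

end Comparison

end Digraph

namespace ListChain

/-! ### Lattice paths as lists, and the sign of a shuffle. -/

section Paths

/-- The lattice paths from `(a, b)` to `(a + m, b + n)`, as lists of points. -/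
def paths : ℕ → ℕ → ℕ → ℕ → Finset (List (ℕ × ℕ))
  | 0, 0, a, b => {[(a, b)]}
  | m + 1, 0, a, b => (paths m 0 (a + 1) b).image (List.cons (a, b))
  | 0, n + 1, a, b => (paths 0 n a (b + 1)).image (List.cons (a, b))
  | m + 1, n + 1, a, b => (paths m (n + 1) (a + 1) b).image (List.cons (a, b)) ∪
      (paths (m + 1) n a (b + 1)).image (List.cons (a, b))
termination_by m n => m + n

/-- Increasing exactly one component by `1`. -/
def LatticeStep (u v : ℕ × ℕ) : Prop :=
  (v.1 = u.1 + 1 ∧ v.2 = u.2) ∨ (v.1 = u.1 ∧ v.2 = u.2 + 1)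

theorem cons_mem_paths_right {m n a b : ℕ} {l : List (ℕ × ℕ)} (h : l ∈ paths m n (a + 1) b) :
    (a, b) :: l ∈ paths (m + 1) n a b := by
  cases n <;> rw [paths]
  · exact Finset.mem_image_of_mem _ h
  · exact Finset.mem_union_left _ (Finset.mem_image_of_mem _ h)

theorem cons_mem_paths_up {m n a b : ℕ} {l : List (ℕ × ℕ)} (h : l ∈ paths m n a (b + 1)) :
    (a, b) :: l ∈ paths m (n + 1) a b := by
  cases m <;> rw [paths]
  · exact Finset.mem_image_of_mem _ h
  · exact Finset.mem_union_right _ (Finset.mem_image_of_mem _ h)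

theorem paths_induction {motive : ℕ → ℕ → ℕ → ℕ → List (ℕ × ℕ) → Prop}
    (nil : ∀ a b, motive 0 0 a b [(a, b)])
    (right : ∀ m n a b l, l ∈ paths m n (a + 1) b → motive m n (a + 1) b l →
      motive (m + 1) n a b ((a, b) :: l))
    (up : ∀ m n a b l, l ∈ paths m n a (b + 1) → motive m n a (b + 1) l →
      motive m (n + 1) a b ((a, b) :: l)) :
    ∀ (m n a b : ℕ) (l : List (ℕ × ℕ)), l ∈ paths m n a b → motive m n a b l
  | 0, 0, a, b, l, h => by
    rw [paths, Finset.mem_singleton] at h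
    exact h ▸ nil a b
  | m + 1, 0, a, b, l, h => by
    rw [paths, Finset.mem_image] at h
    obtain ⟨l, h, rfl⟩ := h
    exact right _ _ _ _ _ h (paths_induction nil right up _ _ _ _ _ h)
  | 0, n + 1, a, b, l, h => by
    rw [paths, Finset.mem_image] at h
    obtain ⟨l, h, rfl⟩ := h
    exact up _ _ _ _ _ h (paths_induction nil right up _ _ _ _ _ h)
  | m + 1, n + 1, a, b, l, h => by
    rw [paths, Finset.mem_union, Finset.mem_image, Finset.mem_image] at h
    obtain ⟨l, h, rfl⟩ | ⟨l, h, rfl⟩ := h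
    · exact right _ _ _ _ _ h (paths_induction nil right up _ _ _ _ _ h)
    · exact up _ _ _ _ _ h (paths_induction nil right up _ _ _ _ _ h)
termination_by m n => m + n

theorem exists_eq_cons_of_mem_paths {m n a b : ℕ} {l : List (ℕ × ℕ)} (h : l ∈ paths m n a b) :
    ∃ l', l = (a, b) :: l' :=
  paths_induction (motive := fun _ _ a b l => ∃ l', l = (a, b) :: l') (fun _ _ => ⟨_, rfl⟩)
    (fun _ _ _ _ _ _ _ => ⟨_, rfl⟩) (fun _ _ _ _ _ _ _ => ⟨_, rfl⟩) m n a b l h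

theorem length_of_mem_paths {m n a b : ℕ} {l : List (ℕ × ℕ)} (h : l ∈ paths m n a b) :
    l.length = m + n + 1 :=
  paths_induction (motive := fun m n _ _ l => l.length = m + n + 1) (fun _ _ => rfl)
    (fun _ _ _ _ _ _ ih => by rw [List.length_cons, ih]; omega)
    (fun _ _ _ _ _ _ ih => by rw [List.length_cons, ih]; omega) m n a b l h

theorem bounds_of_mem_paths {m n a b : ℕ} {l : List (ℕ × ℕ)} (h : l ∈ paths m n a b) :
    ∀ z ∈ l, a ≤ z.1 ∧ z.1 ≤ a + m ∧ b ≤ z.2 ∧ z.2 ≤ b + n :=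
  paths_induction (motive := fun m n a b l => ∀ z ∈ l, a ≤ z.1 ∧ z.1 ≤ a + m ∧ b ≤ z.2 ∧
      z.2 ≤ b + n) (by simp)
    (fun _ _ _ _ _ _ ih => by
      rw [List.forall_mem_cons]
      exact ⟨by simp, fun z hz => by have := ih z hz; omega⟩)
    (fun _ _ _ _ _ _ ih => by
      rw [List.forall_mem_cons]
      exact ⟨by simp, fun z hz => by have := ih z hz; omega⟩) m n a b l h

theorem isChain_of_mem_paths {m n a b : ℕ} {l : List (ℕ × ℕ)} (h : l ∈ paths m n a b) :
    l.IsChain LatticeStep :=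
  paths_induction (motive := fun _ _ _ _ l => l.IsChain LatticeStep) (by simp)
    (fun _ _ _ _ _ h ih => by
      obtain ⟨l, rfl⟩ := exists_eq_cons_of_mem_paths h
      exact List.isChain_cons_cons.2 ⟨Or.inl ⟨rfl, rfl⟩, ih⟩)
    (fun _ _ _ _ _ h ih => by
      obtain ⟨l, rfl⟩ := exists_eq_cons_of_mem_paths h
      exact List.isChain_cons_cons.2 ⟨Or.inr ⟨rfl, rfl⟩, ih⟩) m n a b l h

/-- The increments `m` and `n` are read off by counting steps; neither endpoint is prescribed. -/
theorem exists_ofFn_mem_paths {k : ℕ} (t : Fin (k + 1) → ℕ × ℕ)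
    (ht : ∀ i : Fin k, LatticeStep (t i.castSucc) (t i.succ)) :
    ∃ m n, t (Fin.last k) = ((t 0).1 + m, (t 0).2 + n) ∧
      List.ofFn t ∈ paths m n (t 0).1 (t 0).2 := by
  induction k with
  | zero => exact ⟨0, 0, rfl, by simp [paths]⟩
  | succ k ih =>
    obtain ⟨m, n, h1, h2⟩ := ih (fun i => t i.succ) fun i => ht i.succ
    have h0 : LatticeStep (t 0) (t (Fin.succ 0)) := ht 0
    rw [Fin.succ_last] at h1
    rw [List.ofFn_succ]
    rcases h0 with ⟨e1, e2⟩ | ⟨e1, e2⟩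
    · rw [e1, e2] at h1 h2
      exact ⟨m + 1, n, h1.trans (Prod.ext (by simp; omega) rfl), cons_mem_paths_right h2⟩
    · rw [e1, e2] at h1 h2
      exact ⟨m, n + 1, h1.trans (Prod.ext rfl (by simp; omega)), cons_mem_paths_up h2⟩

/-- The lattice points strictly below a path from `(a, b)` to `(a + m, b + n)`. -/
def belowSet (m n a b : ℕ) (l : List (ℕ × ℕ)) : Finset (ℕ × ℕ) :=
  (Finset.Icc a (a + m) ×ˢ Finset.Icc b (b + n)).filter fun c => ∀ z ∈ l, c.1 = z.1 → c.2 < z.2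

theorem mem_belowSet {m n a b : ℕ} {l : List (ℕ × ℕ)} {c : ℕ × ℕ} : c ∈ belowSet m n a b l ↔
    ((a ≤ c.1 ∧ c.1 ≤ a + m) ∧ (b ≤ c.2 ∧ c.2 ≤ b + n)) ∧ ∀ z ∈ l, c.1 = z.1 → c.2 < z.2 := by
  simp [belowSet]

theorem belowSet_nil (a b : ℕ) : belowSet 0 0 a b [(a, b)] = ∅ := by
  ext c
  simp only [mem_belowSet, List.forall_mem_singleton, Finset.notMem_empty, iff_false]
  omega

/-- Column `a` meets the path at height `b`, so it has no points below the path in the box and can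
be dropped. -/
theorem belowSet_right (m n a b : ℕ) (l : List (ℕ × ℕ)) :
    belowSet (m + 1) n a b ((a, b) :: l) = belowSet m n (a + 1) b l := by
  ext c
  simp only [mem_belowSet, List.forall_mem_cons]
  constructor
  · rintro ⟨h, h1, h2⟩
    exact ⟨by omega, h2⟩
  · rintro ⟨h, h2⟩
    exact ⟨by omega, by omega, h2⟩

theorem belowSet_up {m n a b : ℕ} {l : List (ℕ × ℕ)} (hl : l ∈ paths m n a (b + 1)) :
    belowSet m (n + 1) a b ((a, b) :: l) =
      belowSet m n a (b + 1) l ∪ Finset.Ioc a (a + m) ×ˢ {b} := by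
  have hb := bounds_of_mem_paths hl
  have hmem : (a, b + 1) ∈ l := by
    obtain ⟨l, rfl⟩ := exists_eq_cons_of_mem_paths hl
    exact List.mem_cons_self
  ext c
  simp only [mem_belowSet, List.forall_mem_cons, Finset.mem_union, Finset.mem_product,
    Finset.mem_Ioc, Finset.mem_singleton]
  constructor
  · rintro ⟨h, h1, h2⟩
    by_cases hc : c.2 = b
    · exact Or.inr (by omega)
    · exact Or.inl ⟨by omega, h2⟩
  · rintro (⟨h, h2⟩ | h)
    · have := h2 _ hmem
      exact ⟨by omega, by omega, h2⟩
    · exact ⟨by omega, by omega, fun z hz _ => by have := hb z hz; omega⟩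

/-- Raising the path off row `b` puts one new point below it in each of the `m` columns to the right
of `a`. This is the factor `(-1) ^ x.length` in the recursion of `shL`. -/
theorem card_belowSet_up {m n a b : ℕ} {l : List (ℕ × ℕ)} (hl : l ∈ paths m n a (b + 1)) :
    (belowSet m (n + 1) a b ((a, b) :: l)).card = (belowSet m n a (b + 1) l).card + m := by
  rw [belowSet_up hl, Finset.card_union_of_disjoint]
  · simp
  · rw [Finset.disjoint_left]
    rintro c hc hc'
    rw [mem_belowSet] at hc
    simp only [Finset.mem_product, Finset.mem_singleton] at hc'
    omega

variable {R : Type*} [CommRing R]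

theorem cons_sum_right (m n a b : ℕ) :
    cons (a, b) (∑ l ∈ paths m n (a + 1) b, (-1 : R) ^ (belowSet m n (a + 1) b l).card • nl R l) =
      ∑ l ∈ (paths m n (a + 1) b).image (List.cons (a, b)),
        (-1 : R) ^ (belowSet (m + 1) n a b l).card • nl R l := by
  rw [Finset.sum_image fun _ _ _ _ h => List.tail_eq_of_cons_eq h, map_sum]
  refine Finset.sum_congr rfl fun l _ => ?_
  rw [map_smul, cons_nl, belowSet_right]

theorem cons_sum_up (m n a b : ℕ) :
    (-1 : R) ^ m • cons (a, b) (∑ l ∈ paths m n a (b + 1),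
        (-1 : R) ^ (belowSet m n a (b + 1) l).card • nl R l) =
      ∑ l ∈ (paths m n a (b + 1)).image (List.cons (a, b)),
        (-1 : R) ^ (belowSet m (n + 1) a b l).card • nl R l := by
  rw [Finset.sum_image fun _ _ _ _ h => List.tail_eq_of_cons_eq h, map_sum, Finset.smul_sum]
  refine Finset.sum_congr rfl fun l hl => ?_
  rw [map_smul, cons_nl, card_belowSet_up hl, smul_smul, pow_add, mul_comm]

theorem range'_succ_one (a m : ℕ) : List.range' a (m + 1) = a :: List.range' (a + 1) m :=
  List.range'_succ

/-- The universal case: the lists are intervals of integers, so lists of pairs are literally lattice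
paths, and both sides satisfy the same recursion. -/
theorem shL_range' : ∀ m n a b : ℕ,
    shL R (List.range' a (m + 1)) (List.range' b (n + 1)) =
      ∑ l ∈ paths m n a b, (-1 : R) ^ (belowSet m n a b l).card • nl R l
  | 0, 0, a, b => by
    simp [shL_cons_cons, augL, paths, belowSet_nil]
  | m + 1, 0, a, b => by
    have ih := shL_range' m 0 (a + 1) b
    rw [paths, ← cons_sum_right, ← ih, range'_succ_one a (m + 1), range'_succ_one b 0,
      shL_cons_cons]
    simp [List.range'_succ, augL]
  | 0, n + 1, a, b => by
    have ih := shL_range' 0 n a (b + 1)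
    rw [paths, ← cons_sum_up, ← ih, range'_succ_one a 0, range'_succ_one b (n + 1),
      shL_cons_cons]
    simp [List.range'_succ, augL]
  | m + 1, n + 1, a, b => by
    have ih1 := shL_range' m (n + 1) (a + 1) b
    have ih2 := shL_range' (m + 1) n a (b + 1)
    rw [paths, Finset.sum_union, ← cons_sum_up, ← cons_sum_right, ← ih1, ← ih2,
      range'_succ_one a (m + 1), range'_succ_one b (n + 1), shL_cons_cons]
    · simp [List.range'_succ, augL]
    -- Paths of the two kinds differ in their second point, `(a + 1, b)` against `(a, b + 1)`.
    · rw [Finset.disjoint_left]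
      rintro _ h1 h2
      obtain ⟨l, hl, rfl⟩ := Finset.mem_image.1 h1
      obtain ⟨l', hl', h⟩ := Finset.mem_image.1 h2
      obtain ⟨k, rfl⟩ := exists_eq_cons_of_mem_paths hl
      obtain ⟨k', rfl⟩ := exists_eq_cons_of_mem_paths hl'
      simp at h
termination_by m n => m + n

end Paths

end ListChain

/-! ### Lattice paths indexed by `Fin`, and the explicit shuffle formula. -/

namespace Digraph

open ListChain

/-- The points of a lattice path. -/
def LatticePath.points {p q : ℕ} (σ : LatticePath p q) (s : Fin (p + q + 1)) : ℕ × ℕ :=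
  (((σ.pt s).1 : ℕ), ((σ.pt s).2 : ℕ))

theorem LatticePath.points_step {p q : ℕ} (σ : LatticePath p q) (s : Fin (p + q)) :
    LatticeStep (σ.points s.castSucc) (σ.points s.succ) := by
  rcases σ.step s with ⟨h1, h2⟩ | ⟨h1, h2⟩
  · exact Or.inl ⟨h1, congrArg Fin.val h2⟩
  · exact Or.inr ⟨congrArg Fin.val h1, h2⟩

theorem LatticePath.ofFn_points_mem_paths {p q : ℕ} (σ : LatticePath p q) :
    List.ofFn σ.points ∈ paths p q 0 0 := by
  obtain ⟨m, n, h1, h2⟩ := exists_ofFn_mem_paths σ.points σ.points_step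
  have hlen := length_of_mem_paths h2
  rw [List.length_ofFn] at hlen
  have e1 := congrArg Prod.fst h1
  have e2 := congrArg Prod.snd h1
  have b1 := (σ.pt (Fin.last _)).1.isLt
  have b2 := (σ.pt (Fin.last _)).2.isLt
  simp only [LatticePath.points] at e1 e2 h2 ⊢
  -- A `LatticePath` is not required to start at the origin, but its `p + q` unit steps fit in the
  -- box only if it goes from corner to corner.
  have z1 : ((σ.pt 0).1 : ℕ) = 0 := by omega
  have z2 : ((σ.pt 0).2 : ℕ) = 0 := by omega
  have z3 : m = p := by omega
  have z4 : n = q := by omega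
  rwa [z1, z2, z3, z4] at h2

theorem LatticePath.ofFn_points_injective {p q : ℕ} :
    Function.Injective fun σ : LatticePath p q => List.ofFn σ.points := by
  intro σ τ h
  have h := List.ofFn_injective h
  ext s : 2
  exact Prod.ext (Fin.ext (congrArg Prod.fst (congrFun h s)))
    (Fin.ext (congrArg Prod.snd (congrFun h s)))

theorem LatticePath.exists_ofFn_points_eq {p q : ℕ} {l : List (ℕ × ℕ)} (hl : l ∈ paths p q 0 0) :
    ∃ σ : LatticePath p q, List.ofFn σ.points = l := by
  have hlen := length_of_mem_paths hl
  have hb := bounds_of_mem_paths hl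
  have hc := isChain_of_mem_paths hl
  obtain ⟨t, rfl⟩ : ∃ t : Fin (p + q + 1) → ℕ × ℕ, List.ofFn t = l := ⟨_, ofFn_get_cast l hlen⟩
  rw [List.forall_mem_ofFn_iff] at hb
  rw [List.isChain_ofFn] at hc
  refine ⟨⟨fun s => (⟨(t s).1, by have := hb s; omega⟩, ⟨(t s).2, by have := hb s; omega⟩),
    fun s => ?_⟩, rfl⟩
  rcases hc s (by omega) with ⟨h1, h2⟩ | ⟨h1, h2⟩
  · exact Or.inl ⟨h1, Fin.ext h2⟩
  · exact Or.inr ⟨Fin.ext h1, h2⟩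

theorem LatticePath.card_belowSet {p q : ℕ} (σ : LatticePath p q) :
    (belowSet p q 0 0 (List.ofFn σ.points)).card = σ.below := by
  symm
  refine Finset.card_bij (fun c _ => ((c.1 : ℕ), (c.2 : ℕ))) ?_ ?_ ?_
  · intro c hc
    rw [Finset.mem_filter] at hc
    rw [mem_belowSet, List.forall_mem_ofFn_iff]
    exact ⟨by omega, fun s h => hc.2 s (Fin.ext h)⟩
  · intro c _ c' _ h
    exact Prod.ext (Fin.ext (congrArg Prod.fst h)) (Fin.ext (congrArg Prod.snd h))
  · rintro ⟨i, j⟩ hc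
    rw [mem_belowSet, List.forall_mem_ofFn_iff] at hc
    refine ⟨(⟨i, by omega⟩, ⟨j, by omega⟩), ?_, rfl⟩
    rw [Finset.mem_filter]
    exact ⟨Finset.mem_univ _, fun s h => hc.2 s (congrArg Fin.val h)⟩

theorem ofFn_eq_map_range' {V : Type*} {p : ℕ} (x : Fin (p + 1) → V) :
    List.ofFn x = (List.range' 0 (p + 1)).map fun i => x (Fin.ofNat (p + 1) i) := by
  refine List.ext_getElem (by simp) fun i h1 h2 => ?_
  rw [List.length_ofFn] at h1
  simp [-List.ofFn_succ, Fin.ofNat, Nat.mod_eq_of_lt h1]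

/-- Any pair of tuples is the image of a pair of integer intervals, so naturality of the shuffle
reduces the formula to `shL_range'`. -/
theorem shL_ofFn {R : Type*} [CommRing R] {V W : Type*} {p q : ℕ} (x : Fin (p + 1) → V)
    (y : Fin (q + 1) → W) :
    shL R (List.ofFn x) (List.ofFn y) = ∑ σ : LatticePath p q,
      σ.sign • nl R (List.ofFn fun s => (x (σ.pt s).1, y (σ.pt s).2)) := by
  rw [ofFn_eq_map_range' x, ofFn_eq_map_range' y, ← nmap_shL, shL_range', map_sum]
  symm
  refine Finset.sum_bij (fun σ _ => List.ofFn σ.points) (fun σ _ => σ.ofFn_points_mem_paths)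
    (fun σ _ τ _ h => LatticePath.ofFn_points_injective h) (fun l hl => ?_) fun σ _ => ?_
  · obtain ⟨σ, hσ⟩ := LatticePath.exists_ofFn_points_eq hl
    exact ⟨σ, Finset.mem_univ _, hσ⟩
  · rw [map_smul, nmap_nl, σ.card_belowSet, List.map_ofFn, LatticePath.sign]
    have h : (Prod.map (fun i => x (Fin.ofNat (p + 1) i)) fun i => y (Fin.ofNat (q + 1) i)) ∘
        σ.points = fun s => (x (σ.pt s).1, y (σ.pt s).2) := by
      funext s
      simp [LatticePath.points]
    rw [h, ← Int.cast_smul_eq_zsmul R]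
    push_cast
    rfl

end Digraph

/-! ### Naturality and the formula on generators, for the chain maps themselves. -/

namespace Digraph

open HomologicalComplex ListChain

variable {R : Type u} [CommRing R] {V V' W W' : Type u} {G : Digraph V} {G' : Digraph V'}
  {H : Digraph W} {H' : Digraph W'}

theorem shuffle_naturality (f : Hom G G') (g : Hom H H') :
    shuffle R G H ≫ RCmap R (f.box g) =
      tensorHom (RCmap R f) (RCmap R g) ≫ shuffle R G' H' := by
  ext n t
  apply rcInc_injective (R := R) (G'.box H') n
  change rcInc R _ n (((RCmap R (f.box g)).f n).hom (shuffleHom R G H n t)) =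
    rcInc R _ n (shuffleHom R G' H' n (((tensorHom (RCmap R f) (RCmap R g)).f n).hom t))
  rw [rcInc_RCmap, rcInc_shuffleHom, rcInc_shuffleHom, tInc_tensorHom]
  exact nmap_lift_sh _ _ _

theorem alexanderWhitney_naturality (f : Hom G G') (g : Hom H H') :
    alexanderWhitney R G H ≫ tensorHom (RCmap R f) (RCmap R g) =
      RCmap R (f.box g) ≫ alexanderWhitney R G' H' := by
  ext n z
  apply tInc_injective (R := R) G' H' n
  change tInc R _ _ n (((tensorHom (RCmap R f) (RCmap R g)).f n).hom (awHom R G H n z)) =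
    tInc R _ _ n (awHom R G' H' n (((RCmap R (f.box g)).f n).hom z))
  rw [tInc_tensorHom, tInc_awHom, tInc_awHom, rcInc_RCmap]
  exact map_nmap_aw _ _ _

theorem htMor_naturality (f : Hom G G') (g : Hom H H') (i j : ℕ) :
    htMor R G H i j ≫ (RCmap R (f.box g)).f j = (RCmap R (f.box g)).f i ≫ htMor R G' H' i j := by
  apply ModuleCat.hom_ext
  by_cases hij : i + 1 = j
  · subst hij
    ext1 z
    apply rcInc_injective (R := R) (G'.box H') (i + 1)
    change rcInc R _ _ (((RCmap R (f.box g)).f (i + 1)).hom (htHom R G H i (i + 1) z)) =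
      rcInc R _ _ (htHom R G' H' i (i + 1) (((RCmap R (f.box g)).f i).hom z))
    rw [rcInc_RCmap, rcInc_htHom, rcInc_htHom, rcInc_RCmap]
    exact nmap_ht _ _ _
  · change ((RCmap R (f.box g)).f j).hom ∘ₗ htHom R G H i j =
      htHom R G' H' i j ∘ₗ ((RCmap R (f.box g)).f i).hom
    rw [htHom_eq_zero G H hij, htHom_eq_zero G' H' hij, LinearMap.comp_zero, LinearMap.zero_comp]

variable (G H) in
theorem shuffle_tensorElt {p q : ℕ} (x : G.ReachTuple p) (y : H.ReachTuple q) :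
    ((shuffle R G H).f (p + q)).hom (tensorElt rfl (x.gen R) (y.gen R)) =
      ∑ σ : LatticePath p q, σ.sign • (σ.tuple x y).gen R := by
  apply rcInc_injective (R := R) (G.box H) (p + q)
  refine (rcInc_shuffleHom G H (p + q) _).trans ?_
  rw [tInc_tensorElt, TensorProduct.lift.tmul, rcInc_gen, rcInc_gen, sh_nl, shL_ofFn, map_sum]
  refine Finset.sum_congr rfl fun σ _ => ?_
  rw [map_zsmul, rcInc_gen]
  rfl

end Digraph

theorem mainTheorem10 (R : Type u) [CommRing R] :
    ∃ e : ∀ {V W : Type u} (G : Digraph V) (H : Digraph W),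
        HomotopyEquiv (HomologicalComplex.tensorObj (G.RC R) (H.RC R)) ((G.box H).RC R),
      -- the equivalence is natural: both chain maps and both homotopies
      (∀ {V V' W W' : Type u} {G : Digraph V} {G' : Digraph V'} {H : Digraph W}
          {H' : Digraph W'} (f : Digraph.Hom G G') (g : Digraph.Hom H H'),
        (e G H).hom ≫ Digraph.RCmap R (f.box g) =
          HomologicalComplex.tensorHom (Digraph.RCmap R f) (Digraph.RCmap R g) ≫ (e G' H').hom ∧
        (e G H).inv ≫ HomologicalComplex.tensorHom (Digraph.RCmap R f) (Digraph.RCmap R g) =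
          Digraph.RCmap R (f.box g) ≫ (e G' H').inv ∧
        (∀ i j : ℕ, (e G H).homotopyHomInvId.hom i j ≫
            (HomologicalComplex.tensorHom (Digraph.RCmap R f) (Digraph.RCmap R g)).f j =
          (HomologicalComplex.tensorHom (Digraph.RCmap R f) (Digraph.RCmap R g)).f i ≫
            (e G' H').homotopyHomInvId.hom i j) ∧
        (∀ i j : ℕ, (e G H).homotopyInvHomId.hom i j ≫ (Digraph.RCmap R (f.box g)).f j =
          (Digraph.RCmap R (f.box g)).f i ≫ (e G' H').homotopyInvHomId.hom i j)) ∧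
      -- both chain maps and both homotopies preserve the filtrations
      (∀ {V W : Type u} (G : Digraph V) (H : Digraph W),
        Digraph.IsFilteredMap (Digraph.tensorFil (G.lengthFil R) (H.lengthFil R))
          ((G.box H).lengthFil R) (e G H).hom ∧
        Digraph.IsFilteredMap ((G.box H).lengthFil R)
          (Digraph.tensorFil (G.lengthFil R) (H.lengthFil R)) (e G H).inv ∧
        Digraph.IsFilteredHomotopy (Digraph.tensorFil (G.lengthFil R) (H.lengthFil R))
          (Digraph.tensorFil (G.lengthFil R) (H.lengthFil R)) (e G H).homotopyHomInvId ∧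
        Digraph.IsFilteredHomotopy ((G.box H).lengthFil R) ((G.box H).lengthFil R)
          (e G H).homotopyInvHomId) ∧
      -- the explicit description of the equivalence on generators
      (∀ {V W : Type u} (G : Digraph V) (H : Digraph W) (p q : ℕ) (x : G.ReachTuple p)
          (y : H.ReachTuple q),
        ((e G H).hom.f (p + q)).hom (Digraph.tensorElt rfl (x.gen R) (y.gen R)) =
          ∑ σ : Digraph.LatticePath p q, σ.sign • (σ.tuple x y).gen R) := by
  refine ⟨fun G H => Digraph.eilenbergZilber R G H, ?_, ?_, ?_⟩
  · intro V V' W W' G G' H H' f g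
    exact ⟨Digraph.shuffle_naturality f g, Digraph.alexanderWhitney_naturality f g,
      -- The homotopy `homotopyHomInvId` comes from an equality of chain maps, so all its components
      -- are zero.
      fun i j => Limits.zero_comp.trans Limits.comp_zero.symm, Digraph.htMor_naturality f g⟩
  · intro V W G H
    refine ⟨fun ℓ k a ha => ?_, fun ℓ k a ha => ?_, fun ℓ i j a _ => Submodule.zero_mem _,
      fun ℓ i j a ha => ?_⟩
    · exact Digraph.rcPrj_mem_lengthFil _ (Digraph.lift_sh_tInc_mem_fil G H ha)
    · exact (Digraph.tInc_tPrj_and_tPrj_mem G H (Digraph.aw_rcInc_mem_tfil G H ha)).2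
    · by_cases hij : i + 1 = j
      · subst hij
        exact Digraph.rcPrj_mem_lengthFil _ (Digraph.ht_rcInc_mem_fil G H ha)
      · have h := LinearMap.congr_fun (Digraph.htHom_eq_zero (R := R) G H hij) a
        exact Set.mem_of_eq_of_mem h (Submodule.zero_mem _)
  · intro V W G H p q x y
    exact Digraph.shuffle_tensorElt G H x y
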